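/- **Setting (embeddings).** Let $\lambda$ be a limit ordinal and $j\colon V_\lambda\to V_\lambda$ a nontrivial elementary embedding. For elementary embeddings $a,b\colon V_\lambda\to V_\lambda$ put $a(b)=ab=\bigcup_{\alpha<\lambda}a(b\restriction V_\alpha)$, again an elementary embedding of $V_\lambda$, and let $\mathcal A_j$ be the algebra generated by $j$ under this application. For $k\in\mathcal A_j$ let $\operatorname{crit}k$ be the least ordinal moved by $k$, and let $\gamma_0<\gamma_1<\gamma_2<\cdots$ be the first $\omega$ members, in increasing order, of the set of critical points of members of $\mathcal A_j$. Put $j_{(1)}=j$ and $j_{(m+1)}=j_{(m)}j$. Write $k\colon\alpha\mapsto\alpha'\mapsto\alpha''$ for: $\operatorname{crit}k=\alpha$, $k(\alpha)=\alpha'$ and $k(\alpha')=\alpha''$. **Setting (finite algebras).** For $N\ge 0$ let $*_N$ be the operation on $\{1,\dots,2^N\}$ given by $2^N*_N b=b$ and, for $a<2^N$, $a*_N1=a+1$ and $a*_N(b+1)=(a*_Nb)*_N(a+1)$ for $1\le b<2^N$. Let $A_N$ be this algebra with the element $2^N$ renamed $0$. For a word $k$ in one generator $j$ let $k\bmod 2^N\in\{0,\dots,2^N-1\}$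 be the value of $k$ in $A_N$ when $j$ is evaluated as the generator (the element $1$ of $\{1,\dots,2^N\}$). For $k\in\mathcal A_j$ let $k\bmod 2^N$ be the value of any word that represents $k$; this is the homomorphism $\mathcal A_j\to A_N$ that sends $j$ to the generator. **Theorem.** For every natural number $n$ the following hold. (a) For every $m<n$ there is $\kappa\in\mathcal A_j$ with $\kappa\colon\gamma_{2^n-2^{m+1}}\mapsto\gamma_{2^n-2^m}\mapsto\gamma_{2^n}$. (b) If $k\in\mathcal A_j$ and $k\bmod 2^{2^n}\neq0$, then $k(\gamma_{2^n})\ge\gamma_{2^{n+1}}$. If moreover $k\bmod 2^{2^{n+1}}>2^{2^n}$, then $k(\gamma_{2^n})>\gamma_{2^{n+1}}$. (c) $j_{(2^{2^n}-1)}\colon\gamma_0\mapsto\gamma_{2^n}\mapsto\gamma_{2^{n+1}}$. The same three statements hold, without any assumption on the existence of elementary embeddings, for the finite algebras. There $\mathcal A_j$ is replaced by the set of words in one generator $j$, and the relations with $\gamma$ are read formally: $\operatorname{crit}k\ge\gamma_r$ means $k\bmod2^r=0$; $k(\gamma_s)\ge\gamma_r$ means $(k\,j_{(2^s)})\bmod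 2^r=0$; $\operatorname{crit}k=\gamma_r$, respectively $k(\gamma_s)=\gamma_r$, means that $r$ is the largest number for which $\operatorname{crit}k\ge\gamma_r$, respectively $k(\gamma_s)\ge\gamma_r$, holds; and $k(\gamma_s)>\gamma_r$ means $k(\gamma_s)\ge\gamma_{r+1}$. -/

import Mathlib

universe u

namespace EmbAlg

/-! ### Words in one generator -/

/-- Words built from one generator `j` with one binary operation (written as application). -/
inductive Word : Type
  | gen : Word
  | app : Word → Word → Word

/-- The value of a word for a given operation and a given value of the generator. -/
def Word.eval {α : Type*} (op : α → α → α) (g : α) : Word → α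
  | .gen => g
  | .app k i => op (k.eval op g) (i.eval op g)

/-- `j_(m) = j j ⋯ j` with `m` letters `j`, associated to the left: `j_(1) = j` and
`j_(m+1) = j_(m) j`.  Only `m ≥ 1` is meaningful; `j_(0)` is set to `j`. -/
def Word.leftPow : ℕ → Word
  | 0 => .gen
  | 1 => .gen
  | m + 2 => .app (Word.leftPow (m + 1)) .gen

/-! ### The finite algebras -/

/-- The recursion `2^n * b = b`, `a * 1 = a + 1`, `a * (b + 1) = (a * b) * (a + 1)` (the last two
for `a < 2^n`).  The test `a < a * b` only serves the termination proof and always succeeds, see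
`tableOp_lt`; the values at `b = 0` are irrelevant. -/
def tableOp (n a b : ℕ) : ℕ :=
  if 2 ^ n ≤ a then b
  else
    match b with
    | 0 => 0
    | 1 => a + 1
    | c + 2 =>
      if a < tableOp n a (c + 1) then tableOp n (tableOp n a (c + 1)) (a + 1) else 0
  termination_by (2 ^ n - a, b)
  decreasing_by
    all_goals simp_wf
    all_goals omega

theorem tableOp_top (n b : ℕ) : tableOp n (2 ^ n) b = b := by
  rw [tableOp.eq_def]; simp

theorem tableOp_one {n a : ℕ} (ha : a < 2 ^ n) : tableOp n a 1 = a + 1 := by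
  rw [tableOp]; simp [Nat.not_le.2 ha]

theorem tableOp_bounds (n : ℕ) : ∀ (d a : ℕ), a + d = 2 ^ n → 0 < d → ∀ b, 1 ≤ b →
    a < tableOp n a b ∧ tableOp n a b ≤ 2 ^ n := by
  intro d
  induction d using Nat.strong_induction_on with
  | _ d ih =>
    intro a had hd b hb
    have ha : ¬ 2 ^ n ≤ a := by omega
    induction b, hb using Nat.le_induction with
    | base => rw [tableOp_one (by omega)]; omega
    | succ b hb ihb =>
      obtain ⟨c, rfl⟩ : ∃ c, b = c + 1 := ⟨b - 1, by omega⟩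
      rw [tableOp]
      simp only [ha, if_false, ihb.1, if_true]
      rcases ihb.2.eq_or_lt with h | h
      · rw [h, tableOp_top]; omega
      · have := ih (2 ^ n - tableOp n a (c + 1)) (by omega) (tableOp n a (c + 1)) (by omega)
          (by omega) (a + 1) (by omega)
        omega

theorem tableOp_lt {n a b : ℕ} (ha : a < 2 ^ n) (hb : 1 ≤ b) : a < tableOp n a b :=
  (tableOp_bounds n (2 ^ n - a) a (by omega) (by omega) b hb).1

theorem tableOp_succ {n a b : ℕ} (ha : a < 2 ^ n) (hb : 1 ≤ b) :
    tableOp n a (b + 1) = tableOp n (tableOp n a b) (a + 1) := by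
  obtain ⟨c, rfl⟩ : ∃ c, b = c + 1 := ⟨b - 1, by omega⟩
  conv_lhs => rw [tableOp]
  simp [Nat.not_le.2 ha, tableOp_lt ha hb]

/-- The underlying set `{1, …, 2^n}` of the algebra `A'_n`. -/
abbrev Table (n : ℕ) : Type := {a : ℕ // 1 ≤ a ∧ a ≤ 2 ^ n}

/-- The operation `*_n` of the algebra `A'_n`. -/
def Table.op {n : ℕ} (a b : Table n) : Table n :=
  ⟨tableOp n a.1 b.1, by
    obtain ⟨a, ha1, ha⟩ := a
    obtain ⟨b, hb1, hb⟩ := b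
    rcases ha.eq_or_lt with rfl | h
    · simpa [tableOp_top] using ⟨hb1, hb⟩
    · have := tableOp_bounds n (2 ^ n - a) a (by omega) (by omega) b hb1
      exact ⟨by show 1 ≤ tableOp n a b; omega, this.2⟩⟩

/-- The generator `1` of the algebra `A'_n`. -/
def Table.one (n : ℕ) : Table n := ⟨1, le_rfl, Nat.one_le_two_pow⟩

/-- `k mod 2^n` for a word `k`: its value in `A_n` with `j` set to the generator, where `A_n` is
`A'_n` with the element `2^n` renamed `0`.  It is a number in `{0, …, 2^n - 1}`. -/
def Word.residue (n : ℕ) (k : Word) : ℕ := (k.eval Table.op (Table.one n)).1 % 2 ^ n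

/-- `crit k ≥ γ_n` in the finite algebras. -/
def FinCritGE (k : Word) (n : ℕ) : Prop := k.residue n = 0

/-- `k(γ_m) ≥ γ_n` in the finite algebras. -/
def FinApplyGE (k : Word) (m n : ℕ) : Prop := FinCritGE (.app k (.leftPow (2 ^ m))) n

/-- `crit k = γ_n` in the finite algebras. -/
def FinCritEq (k : Word) (n : ℕ) : Prop := IsGreatest {r | FinCritGE k r} n

/-- `k(γ_m) = γ_n` in the finite algebras. -/
def FinApplyEq (k : Word) (m n : ℕ) : Prop := IsGreatest {r | FinApplyGE k m r} n

/-- `crit k = γ_a`, `k(γ_a) = γ_b` and `k(γ_b) = γ_c` in the finite algebras. -/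
def FinSeq (k : Word) (a b c : ℕ) : Prop := FinCritEq k a ∧ FinApplyEq k a b ∧ FinApplyEq k b c

/-! ### Elementary embeddings of `V_λ` -/

open FirstOrder FirstOrder.Language ZFSet

/-- The only symbol of the language of set theory. -/
inductive memRel : ℕ → Type
  | mem : memRel 2

/-- The first-order language of set theory. -/
def setLang : FirstOrder.Language.{0, 0} := ⟨fun _ => Empty, memRel⟩

/-- The sets of rank less than `lam`. -/
abbrev VSet (lam : Ordinal.{u}) : Type (u + 1) := {x : ZFSet.{u} // x ∈ V_ lam}

/-- `V_λ` as a structure for the language of set theory, with the true membership relation. -/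
instance (lam : Ordinal.{u}) : setLang.Structure (VSet lam) where
  funMap := fun f => f.elim
  RelMap := fun {_} r => match r with
    | .mem => fun v => (v 0).1 ∈ (v 1).1

/-- The elementary embeddings from `V_λ` to `V_λ`. -/
abbrev Emb (lam : Ordinal.{u}) : Type (u + 1) := VSet lam ↪ₑ[setLang] VSet lam

variable {lam : Ordinal.{u}}

/-! #### Definable relations on `V_λ` -/

/-- `R` is first-order definable without parameters over `V_λ`. -/
def Dfn {α : Type} (R : (α → VSet lam) → Prop) : Prop :=
  ∃ φ : setLang.Formula α, ∀ v, φ.Realize v ↔ R v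

theorem Dfn.map {α : Type} {R : (α → VSet lam) → Prop} (h : Dfn R) (f : Emb lam)
    (v : α → VSet lam) : R (f ∘ v) ↔ R v := by
  obtain ⟨φ, hφ⟩ := h
  rw [← hφ, ← hφ, f.map_formula]

theorem Dfn.mem {α : Type} (i k : α) : Dfn (fun v : α → VSet lam => (v i).1 ∈ (v k).1) :=
  ⟨Relations.formula₂ (L := setLang) (show setLang.Relations 2 from memRel.mem)
    (Term.var i) (Term.var k), fun _ => Formula.realize_rel₂⟩

theorem Dfn.eq {α : Type} (i k : α) : Dfn (fun v : α → VSet lam => v i = v k) :=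
  ⟨Term.equal (Term.var i) (Term.var k), fun v => by simp⟩

theorem Dfn.formula {α : Type} (φ : setLang.Formula α) :
    Dfn (fun v : α → VSet lam => φ.Realize v) := ⟨φ, fun _ => Iff.rfl⟩

theorem Dfn.relabel {α β : Type} {R : (α → VSet lam) → Prop} (h : Dfn R) (g : α → β) :
    Dfn (fun v : β → VSet lam => R (v ∘ g)) := by
  obtain ⟨φ, hφ⟩ := h
  exact ⟨φ.relabel g, fun v => by rw [Formula.realize_relabel, hφ]⟩

theorem Dfn.imp {α : Type} {R S : (α → VSet lam) → Prop} (h : Dfn R) (h' : Dfn S) :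
    Dfn (fun v => R v → S v) := by
  obtain ⟨φ, hφ⟩ := h
  obtain ⟨ψ, hψ⟩ := h'
  exact ⟨φ.imp ψ, fun v => by rw [Formula.realize_imp, hφ, hψ]⟩

theorem Dfn.not {α : Type} {R : (α → VSet lam) → Prop} (h : Dfn R) : Dfn (fun v => ¬ R v) := by
  obtain ⟨φ, hφ⟩ := h
  exact ⟨φ.not, fun v => by rw [Formula.realize_not, hφ]⟩

theorem Dfn.and {α : Type} {R S : (α → VSet lam) → Prop} (h : Dfn R) (h' : Dfn S) :
    Dfn (fun v => R v ∧ S v) := by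
  obtain ⟨φ, hφ⟩ := h
  obtain ⟨ψ, hψ⟩ := h'
  exact ⟨φ ⊓ ψ, fun v => by rw [Formula.realize_inf, hφ, hψ]⟩

theorem Dfn.or {α : Type} {R S : (α → VSet lam) → Prop} (h : Dfn R) (h' : Dfn S) :
    Dfn (fun v => R v ∨ S v) := by
  obtain ⟨φ, hφ⟩ := h
  obtain ⟨ψ, hψ⟩ := h'
  exact ⟨φ ⊔ ψ, fun v => by rw [Formula.realize_sup, hφ, hψ]⟩

theorem Dfn.iff {α : Type} {R S : (α → VSet lam) → Prop} (h : Dfn R) (h' : Dfn S) :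
    Dfn (fun v => R v ↔ S v) := by
  obtain ⟨φ, hφ⟩ := h
  obtain ⟨ψ, hψ⟩ := h'
  exact ⟨φ.iff ψ, fun v => by rw [Formula.realize_iff, hφ, hψ]⟩

theorem Dfn.all {α β : Type} [Finite β] {R : (α ⊕ β → VSet lam) → Prop} (h : Dfn R) :
    Dfn (fun v : α → VSet lam => ∀ w : β → VSet lam, R (Sum.elim v w)) := by
  obtain ⟨φ, hφ⟩ := h
  exact ⟨φ.iAlls β, fun v => by simp [Formula.realize_iAlls, hφ]⟩

theorem Dfn.all₁ {α : Type} {R : (α → VSet lam) → VSet lam → Prop}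
    (h : Dfn (fun v : α ⊕ Unit → VSet lam => R (v ∘ Sum.inl) (v (Sum.inr ())))) :
    Dfn (fun v : α → VSet lam => ∀ x, R v x) := by
  obtain ⟨φ, hφ⟩ := h.all
  refine ⟨φ, fun v => (hφ v).trans ⟨fun H x => by simpa using H fun _ => x, fun H w => ?_⟩⟩
  simpa using H (w ())

theorem Dfn.ex₁ {α : Type} {R : (α → VSet lam) → VSet lam → Prop}
    (h : Dfn (fun v : α ⊕ Unit → VSet lam => R (v ∘ Sum.inl) (v (Sum.inr ())))) :
    Dfn (fun v : α → VSet lam => ∃ x, R v x) := by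
  obtain ⟨φ, hφ⟩ := (Dfn.all₁ (R := fun v x => ¬ R v x) h.not).not
  exact ⟨φ, fun v => (hφ v).trans (by simp)⟩

theorem Dfn.forall_fin {α : Type} {n : ℕ} {R : Fin n → (α → VSet lam) → Prop}
    (h : ∀ i, Dfn (R i)) : Dfn (fun v => ∀ i, R i v) := by
  choose φ hφ using h
  exact ⟨Formula.iInf φ, fun v => by simp [Formula.realize_iInf, hφ]⟩

theorem mem_V_of_mem {x y : ZFSet.{u}} (hx : x ∈ y) (hy : y ∈ V_ lam) : x ∈ V_ lam :=
  (isTransitive_vonNeumann lam).subset_of_mem hy hx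

theorem pair_mem_V (hlam : Order.IsSuccLimit lam) {x y : ZFSet.{u}} (hx : x ∈ V_ lam)
    (hy : y ∈ V_ lam) : ({x, y} : ZFSet.{u}) ∈ V_ lam := by
  rw [mem_vonNeumann] at *
  rw [rank_pair]
  exact max_lt (hlam.succ_lt hx) (hlam.succ_lt hy)

theorem singleton_mem_V (hlam : Order.IsSuccLimit lam) {x : ZFSet.{u}} (hx : x ∈ V_ lam) :
    ({x} : ZFSet.{u}) ∈ V_ lam := by
  simpa using pair_mem_V hlam hx hx

theorem ext_V {x y : ZFSet.{u}} (hx : x ∈ V_ lam) (hy : y ∈ V_ lam) :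
    x = y ↔ ∀ z : VSet lam, z.1 ∈ x ↔ z.1 ∈ y := by
  refine ⟨fun h => by simp [h], fun h => ZFSet.ext fun z => ⟨fun hz => ?_, fun hz => ?_⟩⟩
  · exact (h ⟨z, mem_V_of_mem hz hx⟩).1 hz
  · exact (h ⟨z, mem_V_of_mem hz hy⟩).2 hz

theorem isPair_iff (hlam : Order.IsSuccLimit lam) (q x y : VSet lam) :
    q.1 = pair x.1 y.1 ↔ ∀ z : VSet lam, z.1 ∈ q.1 ↔
      ((∀ t : VSet lam, t.1 ∈ z.1 ↔ t = x) ∨ (∀ t : VSet lam, t.1 ∈ z.1 ↔ t = x ∨ t = y)) := by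
  have h1 := singleton_mem_V hlam x.2
  have h2 := pair_mem_V hlam x.2 y.2
  have h3 : pair x.1 y.1 ∈ V_ lam := pair_mem_V hlam h1 h2
  rw [ext_V q.2 h3]
  refine forall_congr' fun z => ?_
  have e1 : z.1 = {x.1} ↔ ∀ t : VSet lam, t.1 ∈ z.1 ↔ t = x := by
    rw [ext_V z.2 h1]; simp only [mem_singleton, Subtype.ext_iff]
  have e2 : z.1 = {x.1, y.1} ↔ ∀ t : VSet lam, t.1 ∈ z.1 ↔ t = x ∨ t = y := by
    rw [ext_V z.2 h2]; simp only [mem_pair, Subtype.ext_iff]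
  rw [← e1, ← e2]
  simp [pair]

theorem Dfn.pairMem (hlam : Order.IsSuccLimit lam) {α : Type} (x y p : α) :
    Dfn (fun v : α → VSet lam => pair (v x).1 (v y).1 ∈ (v p).1) := by
  have key : Dfn (fun v : α → VSet lam => ∃ q : VSet lam, q.1 ∈ (v p).1 ∧
      ∀ z : VSet lam, z.1 ∈ q.1 ↔ ((∀ t : VSet lam, t.1 ∈ z.1 ↔ t = v x) ∨
        (∀ t : VSet lam, t.1 ∈ z.1 ↔ t = v x ∨ t = v y))) := by
    refine Dfn.ex₁ (Dfn.and (Dfn.mem _ _) (Dfn.all₁ (Dfn.iff (Dfn.mem _ _) (Dfn.or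
      (Dfn.all₁ (Dfn.iff (Dfn.mem _ _) (Dfn.eq _ _)))
      (Dfn.all₁ (Dfn.iff (Dfn.mem _ _) (Dfn.or (Dfn.eq _ _) (Dfn.eq _ _))))))))
  obtain ⟨φ, hφ⟩ := key
  refine ⟨φ, fun v => (hφ v).trans ?_⟩
  simp only [← isPair_iff hlam]
  refine ⟨?_, fun h => ⟨⟨_, mem_V_of_mem h (v p).2⟩, h, rfl⟩⟩
  rintro ⟨q, hq, e⟩
  rwa [← e]

/-! #### Application of embeddings -/

theorem emb_mem (f : Emb lam) (x y : VSet lam) : (f x).1 ∈ (f y).1 ↔ x.1 ∈ y.1 :=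
  (Dfn.mem (0 : Fin 2) 1).map f ![x, y]

theorem emb_subset (f : Emb lam) {x y : VSet lam} (h : x.1 ⊆ y.1) : (f x).1 ⊆ (f y).1 := by
  have key : Dfn (fun v : Fin 2 → VSet lam => ∀ z : VSet lam, z.1 ∈ (v 0).1 → z.1 ∈ (v 1).1) :=
    Dfn.all₁ (Dfn.imp (Dfn.mem _ _) (Dfn.mem _ _))
  have := (key.map f ![x, y]).2 fun z hz => h hz
  intro z hz
  exact this ⟨z, mem_V_of_mem hz (f x).2⟩ hz

/-- The set `V_α` as an element of `V_λ`, for `α < λ`. -/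
noncomputable def lev (α : Ordinal.{u}) (hα : α < lam) : VSet lam := ⟨V_ α, vonNeumann_mem_of_lt hα⟩

theorem subset_emb_lev (hlam : Order.IsSuccLimit lam) (f : Emb lam) (α : Ordinal.{u})
    (hα : α < lam) : V_ α ⊆ (f (lev α hα)).1 := by
  induction α using WellFoundedLT.induction with
  | _ α ih =>
    intro x hx
    obtain ⟨β, hβ, hxβ⟩ := mem_vonNeumann'.1 hx
    have hβl := hβ.trans hα
    have hsl := hlam.succ_lt hβl
    have hP : Dfn (fun v : Fin 2 → VSet lam => ∀ z : VSet lam, z.1 ∈ (v 0).1 ↔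
        ∀ t : VSet lam, t.1 ∈ z.1 → t.1 ∈ (v 1).1) :=
      Dfn.all₁ (Dfn.iff (Dfn.mem _ _) (Dfn.all₁ (Dfn.imp (Dfn.mem _ _) (Dfn.mem _ _))))
    have h0 : ∀ z : VSet lam, z.1 ∈ (lev (Order.succ β) hsl).1 ↔
        ∀ t : VSet lam, t.1 ∈ z.1 → t.1 ∈ (lev β hβl).1 := by
      intro z
      simp only [lev, mem_vonNeumann (o := Order.succ β), Order.lt_succ_iff, ← subset_vonNeumann]
      exact ⟨fun h t ht => h ht, fun h t ht => h ⟨t, mem_V_of_mem ht z.2⟩ ht⟩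
    have h1 := (hP.map f ![lev (Order.succ β) hsl, lev β hβl]).2 h0
    have hxV : x ∈ V_ lam := vonNeumann_subset_of_le hα.le hx
    have h2 : x ∈ (f (lev (Order.succ β) hsl)).1 :=
      (h1 ⟨x, hxV⟩).2 fun t ht => ih β hβ hβl (hxβ ht)
    exact emb_subset f (x := lev (Order.succ β) hsl) (y := lev α hα)
      (vonNeumann_subset_of_le (Order.succ_le_of_lt hβ)) h2

theorem graph_mem_V (hlam : Order.IsSuccLimit lam) (p : ZFSet.{u} → ZFSet.{u} → Prop)
    (x y : VSet lam) : pairSep p x.1 y.1 ∈ V_ lam := by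
  have hx := mem_vonNeumann.1 x.2
  have hy := mem_vonNeumann.1 y.2
  rw [mem_vonNeumann]
  refine (rank_mono (y := powerset (powerset (x.1 ∪ y.1))) ?_).trans_lt ?_
  · exact sep_subset
  · rw [rank_powerset, rank_powerset, rank_union]
    exact hlam.succ_lt (hlam.succ_lt (max_lt hx hy))

/-- The restriction `b ↾ V_α`, a set of ordered pairs, as an element of `V_λ`. -/
noncomputable def restr (hlam : Order.IsSuccLimit lam) (b : Emb lam) (α : Ordinal.{u}) (hα : α < lam) :
    VSet lam :=
  ⟨pairSep (fun x y => ∃ h : x ∈ V_ lam, (b ⟨x, h⟩).1 = y) (V_ α) (b (lev α hα)).1,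
    graph_mem_V hlam _ (lev α hα) (b (lev α hα))⟩

theorem pair_mem_restr (hlam : Order.IsSuccLimit lam) (b : Emb lam) (α : Ordinal.{u})
    (hα : α < lam) (x y : VSet lam) :
    pair x.1 y.1 ∈ (restr hlam b α hα).1 ↔ x.1 ∈ V_ α ∧ b x = y := by
  simp only [restr, mem_pairSep, pair_inj]
  constructor
  · rintro ⟨s, hs, t, -, ⟨hxs, hyt⟩, h1, h2⟩
    subst hxs hyt
    exact ⟨hs, Subtype.ext h2⟩
  · rintro ⟨hx, rfl⟩
    exact ⟨x.1, hx, (b x).1, (emb_mem b x (lev α hα)).2 hx, ⟨rfl, rfl⟩, x.2, rfl⟩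

/-- The relation `y = a(b)(x)`, where `a(b) = ⋃_{α < λ} a(b ↾ V_α)`. -/
def AppRel (hlam : Order.IsSuccLimit lam) (a b : Emb lam) (x y : VSet lam) : Prop :=
  ∃ (α : Ordinal.{u}) (hα : α < lam), pair x.1 y.1 ∈ (a (restr hlam b α hα)).1

theorem restr_mono (hlam : Order.IsSuccLimit lam) (a b : Emb lam) {α β : Ordinal.{u}}
    (hα : α < lam) (hβ : β < lam) (h : α ≤ β) :
    (a (restr hlam b α hα)).1 ⊆ (a (restr hlam b β hβ)).1 := by
  apply emb_subset
  intro q hq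
  obtain ⟨s, hs, t, ht, rfl, -⟩ := mem_pairSep.1 hq
  have hs' := vonNeumann_subset_of_le hα.le hs
  have ht' := mem_V_of_mem ht (b (lev α hα)).2
  have := (pair_mem_restr hlam b α hα ⟨s, hs'⟩ ⟨t, ht'⟩).1 hq
  exact (pair_mem_restr hlam b β hβ ⟨s, hs'⟩ ⟨t, ht'⟩).2
    ⟨vonNeumann_subset_of_le h this.1, this.2⟩

theorem appRel_formula (hlam : Order.IsSuccLimit lam) (a b : Emb lam) {n : ℕ}
    (φ : setLang.Formula (Fin n)) (v w : Fin n → VSet lam)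
    (h : ∀ i, AppRel hlam a b (v i) (w i)) : φ.Realize w ↔ φ.Realize v := by
  choose α hα hp using h
  have hpos : (⊥ : Ordinal.{u}) < lam := hlam.bot_lt
  have hsup : Finset.univ.sup α < lam := (Finset.sup_lt_iff hpos).2 fun i _ => hα i
  have key : Dfn (fun p : Unit → VSet lam => ∀ u : Fin n ⊕ Fin n → VSet lam,
      (∀ i, pair (u (Sum.inl i)).1 (u (Sum.inr i)).1 ∈ (p ()).1) →
        (φ.Realize (u ∘ Sum.inr) ↔ φ.Realize (u ∘ Sum.inl))) := by
    refine Dfn.all (R := fun v : Unit ⊕ (Fin n ⊕ Fin n) → VSet lam =>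
      (∀ i, pair (v (Sum.inr (Sum.inl i))).1 (v (Sum.inr (Sum.inr i))).1 ∈ (v (Sum.inl ())).1) →
        (φ.Realize (v ∘ (Sum.inr ∘ Sum.inr)) ↔ φ.Realize (v ∘ (Sum.inr ∘ Sum.inl)))) ?_
    exact (Dfn.forall_fin fun i => Dfn.pairMem hlam _ _ _).imp
      (((Dfn.formula φ).relabel _).iff ((Dfn.formula φ).relabel _))
  have h0 := (key.map a fun _ => restr hlam b _ hsup).2 (by
    intro u hu
    have : u ∘ Sum.inr = b ∘ (u ∘ Sum.inl) := funext fun i =>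
      ((pair_mem_restr hlam b _ hsup _ _).1 (hu i)).2.symm
    rw [this, b.map_formula])
  exact h0 (Sum.elim v w) fun i =>
    restr_mono hlam a b (hα i) hsup (Finset.le_sup (Finset.mem_univ i)) (hp i)

theorem appRel_existsUnique (hlam : Order.IsSuccLimit lam) (a b : Emb lam) (x : VSet lam) :
    ∃! y, AppRel hlam a b x y := by
  have hr := hlam.succ_lt (mem_vonNeumann.1 x.2)
  have key : Dfn (fun v : Fin 2 → VSet lam => ∀ s : VSet lam, s.1 ∈ (v 0).1 →
      ∃ t : VSet lam, pair s.1 t.1 ∈ (v 1).1) :=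
    Dfn.all₁ (Dfn.imp (Dfn.mem _ _) (Dfn.ex₁ (Dfn.pairMem hlam _ _ _)))
  have h0 := (key.map a ![lev _ hr, restr hlam b _ hr]).2 fun s hs =>
    ⟨b s, (pair_mem_restr hlam b _ hr s (b s)).2 ⟨hs, rfl⟩⟩
  obtain ⟨y, hy⟩ := h0 x (subset_emb_lev hlam a _ hr (mem_vonNeumann_succ x.1))
  refine ⟨y, ⟨_, hr, hy⟩, fun z hz => ?_⟩
  have := appRel_formula hlam a b
    (Term.equal (Term.var (0 : Fin 2)) (Term.var 1) : setLang.Formula (Fin 2))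
    ![x, x] ![z, y] (by
      intro i
      fin_cases i
      · exact hz
      · exact ⟨_, hr, hy⟩)
  simpa using this

/-- The application `a(b) = ⋃_{α < λ} a(b ↾ V_α)`, again an elementary embedding. -/
noncomputable def app (hlam : Order.IsSuccLimit lam) (a b : Emb lam) : Emb lam where
  toFun x := (appRel_existsUnique hlam a b x).choose
  map_formula' _ φ v := appRel_formula hlam a b φ v _ fun i =>
    (appRel_existsUnique hlam a b (v i)).choose_spec.1

/-! #### The algebra generated by one embedding, and its critical points -/

/-- The embedding moves some set. -/
def Nontriv (k : Emb lam) : Prop := ∃ x, k x ≠ x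

/-- The subalgebra `𝒜_j` generated by `j` under application. -/
inductive InAlg (hlam : Order.IsSuccLimit lam) (j : Emb lam) : Emb lam → Prop
  | gen : InAlg hlam j j
  | app {a b : Emb lam} : InAlg hlam j a → InAlg hlam j b → InAlg hlam j (app hlam a b)

/-- The value in `𝒜_j` of a word. -/
noncomputable def Word.toEmb (hlam : Order.IsSuccLimit lam) (j : Emb lam) (w : Word) : Emb lam :=
  w.eval (EmbAlg.app hlam) j

/-- `k mod 2^N = r` for `k ∈ 𝒜_j`: the homomorphism from `𝒜_j` to `A_N` that sends `j` to the
generator takes `k` to `r`, that is, some way of writing `k` as a word in `j` has the value `r`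
in `A_N`. -/
def HasResidue (hlam : Order.IsSuccLimit lam) (j : Emb lam) (N : ℕ) (k : Emb lam) (r : ℕ) : Prop :=
  ∃ w : Word, w.toEmb hlam j = k ∧ w.residue N = r

/-- The (von Neumann) ordinal `α < λ` as an element of `V_λ`. -/
noncomputable def ordSet (α : Ordinal.{u}) (hα : α < lam) : VSet lam :=
  ⟨α.toZFSet, by rw [mem_vonNeumann, Ordinal.rank_toZFSet]; exact hα⟩

/-- `k(α) = β`, for ordinals `α, β < λ`. -/
def MapsOrd (k : Emb lam) (α β : Ordinal.{u}) : Prop :=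
  ∃ (hα : α < lam) (hβ : β < lam), k (ordSet α hα) = ordSet β hβ

/-- `crit k = α`: the ordinal `α < λ` is the least one moved by `k`. -/
def IsCrit (k : Emb lam) (α : Ordinal.{u}) : Prop :=
  α < lam ∧ ¬ MapsOrd k α α ∧ ∀ β < α, MapsOrd k β β

/-- The critical points of the members of `𝒜_j`. -/
def critSet (hlam : Order.IsSuccLimit lam) (j : Emb lam) : Set Ordinal.{u} :=
  {α | ∃ k, InAlg hlam j k ∧ IsCrit k α}

/-- `γ_0 < γ_1 < ⋯`, the first `ω` critical points of members of `𝒜_j` in increasing order (an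
infinite set of ordinals if `j` is nontrivial). -/
noncomputable def gam (hlam : Order.IsSuccLimit lam) (j : Emb lam) : ℕ → Ordinal.{u}
  | 0 => sInf (critSet hlam j)
  | n + 1 => sInf {α | α ∈ critSet hlam j ∧ gam hlam j n < α}

/-- `crit k = α`, `k(α) = β` and `k(β) = δ`. -/
def EmbSeq (k : Emb lam) (α β δ : Ordinal.{u}) : Prop :=
  IsCrit k α ∧ MapsOrd k α β ∧ MapsOrd k β δ

end EmbAlg

namespace EmbAlg

/-! ### Basic theory of the tables -/

/-! Everything is proved for words in the finite algebras and then transferred. For a word `k`,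
`Word.crit` is the index of its critical point and `Word.ap` is its action on indices. The tables
supply the calculus of embeddings: crit(kl) = k(crit l); k(l(x)) = (kl)(k(x)), by left
distributivity; and `k` is strictly increasing on finite indices with finite image, fixes those
below crit k and moves up the finite ones from there on.

Put M = 2^n. The three statements are proved by one induction on `n`, with (a) as induction
hypothesis (`Ladder`). (a) implies (b): if crit k = 0 and k(0) ≥ M, then strict monotonicity gives
k(M) ≥ 2M, and counting multiples of 2^M in the row of `k` gives the refinement
(`doubles_of_crit_eq_zero`). Any other `k` with crit k < M is replaced by kκ with κ from the ladder,
chosen so that (kκ)(M) ≤ k(M). Since kκ also has the larger value in the table, both halves of (b)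
pass from kκ back to `k` (`Doubles.of_app`). (b) implies (c): by the refinement, in the table of
size 2^(2M+1) the relevant rows have period dividing 2^M. This makes the row of 2^M - 1 computable:
its i-th entry is 2^M i for i ≤ 2^M. Hence j_(2^M - 1) sends 0 to M and M to exactly 2M. (c) implies
(a) for n+1: by strict monotonicity j_(2^M - 1) sends i to M + i for i ≤ M. Applying it to the old
ladder words translates them by M, and j_(2^M - 1) itself is the one new ladder word
(`Ladder.succ`).

For embeddings, application of the j_(a) agrees with the table of size 2^n up to the level crit
j_(2^n). The critical point of j_(m) depends only on the power of two dividing `m`, and the crit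
j_(2^n) increase and are exactly the γ_n (`CritPattern`, `gam_eq_critPow`). So crit w ≥ γ_r means
that `w` vanishes in the r-th table (`finCritGE_iff_gam_le`), and the finite statements carry over.
-/

theorem tableOp_le {n a b : ℕ} (ha : a < 2 ^ n) (hb : 1 ≤ b) : tableOp n a b ≤ 2 ^ n :=
  (tableOp_bounds n (2 ^ n - a) a (by omega) (by omega) b hb).2

theorem tableOp_zero {n b : ℕ} (hb : 1 ≤ b) (hb' : b ≤ 2 ^ n) : tableOp n 0 b = b := by
  induction b, hb using Nat.le_induction with
  | base => exact tableOp_one (by omega)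
  | succ b hb ih =>
    rw [tableOp_succ (by omega) hb, ih (by omega), zero_add, tableOp_one (by omega)]

theorem tableOp_add_period {n a p : ℕ} (ha : a < 2 ^ n) (hp : 1 ≤ p)
    (h : tableOp n a p = 2 ^ n) {b : ℕ} (hb : 1 ≤ b) : tableOp n a (p + b) = tableOp n a b := by
  induction b, hb using Nat.le_induction with
  | base => rw [tableOp_succ ha hp, h, tableOp_top, tableOp_one ha]
  | succ b hb ih => rw [← add_assoc, tableOp_succ ha (by omega), ih, tableOp_succ ha hb]

theorem tableOp_mul_period {n a p : ℕ} (ha : a < 2 ^ n) (hp : 1 ≤ p)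
    (h : tableOp n a p = 2 ^ n) {t : ℕ} (ht : 1 ≤ t) : tableOp n a (p * t) = 2 ^ n := by
  induction t, ht using Nat.le_induction with
  | base => simpa using h
  | succ t ht ih =>
    rw [mul_add, mul_one, add_comm, tableOp_add_period ha hp h (Nat.mul_pos hp ht), ih]

theorem tableOp_mul_period_add {n a p : ℕ} (ha : a < 2 ^ n) (hp : 1 ≤ p)
    (h : tableOp n a p = 2 ^ n) (t : ℕ) {b : ℕ} (hb : 1 ≤ b) :
    tableOp n a (p * t + b) = tableOp n a b := by
  rcases Nat.eq_zero_or_pos t with rfl | ht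
  · simp
  · exact tableOp_add_period ha (Nat.mul_pos hp ht) (tableOp_mul_period ha hp h ht) hb

/-- If a row takes the value `2^n`, then it does so exactly at the multiples of some number. -/
theorem exists_period {n a c : ℕ} (ha : a < 2 ^ n) (hc : 1 ≤ c) (h : tableOp n a c = 2 ^ n) :
    ∃ p, 1 ≤ p ∧ (∀ b, 1 ≤ b → (tableOp n a b = 2 ^ n ↔ p ∣ b)) := by
  classical
  have hex : ∃ p, 1 ≤ p ∧ tableOp n a p = 2 ^ n := ⟨c, hc, h⟩
  obtain ⟨h1, h2⟩ := Nat.find_spec hex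
  set p := Nat.find hex with hp
  refine ⟨p, h1, fun b hb => ⟨fun hbt => ?_, ?_⟩⟩
  · by_contra hd
    have hr : 1 ≤ b % p := Nat.one_le_iff_ne_zero.2 fun h0 => hd (Nat.dvd_of_mod_eq_zero h0)
    have hlt : b % p < p := Nat.mod_lt _ h1
    refine Nat.find_min hex hlt ⟨hr, ?_⟩
    rw [← tableOp_mul_period_add ha h1 h2 (b / p) hr, Nat.div_add_mod, hbt]
  · rintro ⟨t, rfl⟩
    exact tableOp_mul_period ha h1 h2 (Nat.pos_of_mul_pos_left hb)

/-- The property `a * 2^n = 2^n` for all `a`, proved by induction on `n` below. -/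
def TopColumn (n : ℕ) : Prop := ∀ a < 2 ^ n, tableOp n a (2 ^ n) = 2 ^ n

theorem TopColumn.add {n : ℕ} (H : TopColumn n) {a b : ℕ} (ha : a < 2 ^ n) (hb : 1 ≤ b) :
    tableOp n a (2 ^ n + b) = tableOp n a b :=
  tableOp_add_period ha Nat.one_le_two_pow (H a ha) hb

/-- Downward induction on `a`: the two recursions run in parallel. `H` is needed because the
argument 2^n + a + 1 has to act like a + 1 in a row of the smaller table. -/
theorem TopColumn.upper {n : ℕ} (H : TopColumn n) : ∀ (d a : ℕ), a + d = 2 ^ n → 0 < d →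
    ∀ b, 1 ≤ b → tableOp (n + 1) (2 ^ n + a) b = 2 ^ n + tableOp n a b := by
  intro d
  induction d using Nat.strong_induction_on with
  | _ d ih =>
    intro a had hd b hb
    have hpow : 2 ^ (n + 1) = 2 ^ n + 2 ^ n := by ring
    induction b, hb using Nat.le_induction with
    | base => rw [tableOp_one (by omega), tableOp_one (by omega)]; ring
    | succ b hb ihb =>
      rw [tableOp_succ (by omega) hb, ihb, tableOp_succ (by omega) hb]
      have h1 := tableOp_lt (n := n) (a := a) (b := b) (by omega) hb
      rcases (tableOp_le (n := n) (a := a) (b := b) (by omega) hb).eq_or_lt with h | h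
      · rw [h, ← hpow, tableOp_top, tableOp_top]; ring
      · rw [ih (2 ^ n - tableOp n a b) (by omega) _ (by omega) (by omega) _ (by omega),
          add_assoc, H.add h (by omega)]

/-- An old entry 2^n lifts either to 2^n, after which the row continues in the upper half, or to
2^(n+1), after which it starts afresh. -/
theorem TopColumn.lower {n : ℕ} (H : TopColumn n) : ∀ (d a : ℕ), a + d = 2 ^ n → 0 < d →
    ∀ b, 1 ≤ b → tableOp (n + 1) a b = tableOp n a b ∨
      tableOp (n + 1) a b = 2 ^ n + tableOp n a b := by
  intro d
  induction d using Nat.strong_induction_on with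
  | _ d ih =>
    intro a had hd b hb
    have hpow : 2 ^ (n + 1) = 2 ^ n + 2 ^ n := by ring
    have htop : tableOp (n + 1) (2 ^ n) (a + 1) = 2 ^ n + (a + 1) := by
      simpa [tableOp_zero (n := n) (b := a + 1) (by omega) (by omega)] using
        H.upper (2 ^ n) 0 (by omega) (by omega) (a + 1) (by omega)
    induction b, hb using Nat.le_induction with
    | base => left; rw [tableOp_one (by omega), tableOp_one (by omega)]
    | succ b hb ihb =>
      rw [tableOp_succ (by omega) hb, tableOp_succ (by omega) hb]
      have h1 := tableOp_lt (n := n) (a := a) (b := b) (by omega) hb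
      rcases (tableOp_le (n := n) (a := a) (b := b) (by omega) hb).eq_or_lt with h | h
      · rcases ihb with e | e
        · right; rw [e, h, htop, tableOp_top]
        · left; rw [e, h, ← hpow, tableOp_top, tableOp_top]
      · rcases ihb with e | e
        · rw [e]
          exact ih (2 ^ n - tableOp n a b) (by omega) _ (by omega) (by omega) _ (by omega)
        · right
          rw [e]
          exact H.upper (2 ^ n - tableOp n a b) _ (by omega) (by omega) _ (by omega)

/-- After an entry 2^n comes 2^n + (a + 1); from there the upper rows repeat the old row, raised by
2^n, until it reaches its top. -/
theorem TopColumn.shift {n : ℕ} (H : TopColumn n) {a p : ℕ} (ha : a < 2 ^ n) (hp : 1 ≤ p)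
    (h : tableOp (n + 1) a p = 2 ^ n) {b : ℕ} (hb : 1 ≤ b)
    (hlt : ∀ b', 1 ≤ b' → b' < b → tableOp n a b' ≠ 2 ^ n) :
    tableOp (n + 1) a (p + b) = 2 ^ n + tableOp n a b := by
  have hpow : 2 ^ (n + 1) = 2 ^ n + 2 ^ n := by ring
  induction b, hb using Nat.le_induction with
  | base =>
    rw [tableOp_succ (by omega) hp, h, tableOp_one ha]
    simpa [tableOp_zero (n := n) (b := a + 1) (by omega) (by omega)] using
        H.upper (2 ^ n) 0 (by omega) (by omega) (a + 1) (by omega)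
  | succ b hb ih =>
    have h1 := tableOp_le ha hb
    have h2 := hlt b hb (by omega)
    rw [← add_assoc, tableOp_succ (by omega) (by omega), ih fun b' h h' => hlt b' h (by omega),
      tableOp_succ ha hb]
    exact H.upper (2 ^ n - tableOp n a b) _ (by omega) (by omega) _ (by omega)

/-- At the old period the new entry is either already 2^(n+1), or it is 2^n and a second run through
the old row, now raised, ends at 2^(n+1). -/
theorem TopColumn.double {n : ℕ} (H : TopColumn n) {a p : ℕ} (ha : a < 2 ^ n) (hp : 1 ≤ p)
    (h : tableOp n a p = 2 ^ n) : tableOp (n + 1) a (2 * p) = 2 ^ (n + 1) := by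
  have hpow : 2 ^ (n + 1) = 2 ^ n + 2 ^ n := by ring
  obtain ⟨q, hq, hper⟩ := exists_period ha hp h
  have hqt : tableOp n a q = 2 ^ n := (hper q hq).2 dvd_rfl
  obtain ⟨t, rfl⟩ := (hper p hp).1 h
  have ht : 1 ≤ t := Nat.pos_of_mul_pos_left hp
  have key : tableOp (n + 1) a (q * 2) = 2 ^ (n + 1) := by
    rcases H.lower (2 ^ n - a) a (by omega) (by omega) q hq with e | e
    · rw [mul_two, H.shift ha hq (e.trans hqt) hq, hqt, hpow]
      intro b hb hbq e
      exact absurd (Nat.le_of_dvd hb ((hper b hb).1 e)) (by omega)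
    · exact tableOp_mul_period (by omega) hq (by rw [e, hqt, hpow]) (by omega)
  have := tableOp_mul_period (a := a) (by omega) (by omega) key ht
  rwa [show q * 2 * t = 2 * (q * t) by ring] at this

theorem topColumn (n : ℕ) : TopColumn n := by
  induction n with
  | zero =>
    intro a ha
    obtain rfl : a = 0 := by simpa using ha
    exact tableOp_zero (by simp) (by simp)
  | succ n H =>
    have hpow : 2 ^ (n + 1) = 2 ^ n + 2 ^ n := by ring
    intro a ha
    rcases lt_or_ge a (2 ^ n) with h | h
    · rw [pow_succ' 2 n]
      exact (H.double h Nat.one_le_two_pow (H a h)).trans (pow_succ' 2 n)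
    · obtain ⟨c, rfl⟩ := Nat.exists_eq_add_of_le h
      rw [H.upper (2 ^ n - c) c (by omega) (by omega) _ Nat.one_le_two_pow, hpow,
        H.add (by omega) Nat.one_le_two_pow, H c (by omega)]

theorem tableOp_two_pow {n a : ℕ} (ha : a ≤ 2 ^ n) : tableOp n a (2 ^ n) = 2 ^ n := by
  rcases ha.eq_or_lt with rfl | h
  · exact tableOp_top n _
  · exact topColumn n a h

/-- The period of a row is a power of two. -/
theorem exists_two_pow_period {n a : ℕ} (ha : a ≤ 2 ^ n) :
    ∃ q ≤ n, ∀ b, 1 ≤ b → b ≤ 2 ^ n → (tableOp n a b = 2 ^ n ↔ 2 ^ q ∣ b) := by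
  rcases ha.eq_or_lt with rfl | h
  · refine ⟨n, le_rfl, fun b hb hb' => ?_⟩
    rw [tableOp_top]
    exact ⟨fun e => e ▸ dvd_rfl, fun hd => le_antisymm hb' (Nat.le_of_dvd hb hd)⟩
  · obtain ⟨p, hp, hper⟩ := exists_period h Nat.one_le_two_pow (topColumn n a h)
    obtain ⟨q, hq, rfl⟩ := (Nat.dvd_prime_pow Nat.prime_two).1
      ((hper _ Nat.one_le_two_pow).1 (topColumn n a h))
    exact ⟨q, hq, fun b hb _ => hper b hb⟩

/-- The left distributive law. -/
theorem tableOp_distrib (n : ℕ) : ∀ (d a : ℕ), a + d = 2 ^ n → ∀ (f b : ℕ), b + f = 2 ^ n →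
    1 ≤ b → ∀ c, 1 ≤ c → tableOp n a (tableOp n b c) = tableOp n (tableOp n a b) (tableOp n a c) := by
  intro d
  induction d using Nat.strong_induction_on with
  | _ d ihd =>
    intro a had f
    rcases Nat.eq_zero_or_pos d with rfl | hd
    · obtain rfl : a = 2 ^ n := by omega
      intros; simp only [tableOp_top]
    have ha : a < 2 ^ n := by omega
    induction f using Nat.strong_induction_on with
    | _ f ihf =>
      intro b hbf hb c hc
      rcases Nat.eq_zero_or_pos f with rfl | hf
      · obtain rfl : b = 2 ^ n := by omega
        rw [topColumn n a ha, tableOp_top, tableOp_top]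
      have hb' : b < 2 ^ n := by omega
      induction c, hc using Nat.le_induction with
      | base => rw [tableOp_one hb', tableOp_one ha, tableOp_succ ha hb]
      | succ c hc ihc =>
        have h1 := tableOp_lt hb' hc
        have h2 := tableOp_le hb' hc
        have h3 := tableOp_lt ha hb
        have h4 := tableOp_le ha hb
        have h5 := tableOp_lt ha hc
        have h6 := tableOp_le ha hc
        -- a(b(c+1)) = a((bc)(b+1)) = (a(bc))(a(b+1)) = ((ab)(ac))((ab)(a+1)) = (ab)((ac)(a+1)) =
        -- (ab)(a(c+1)), using that bc > b and ab > a.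
        rw [tableOp_succ hb' hc, ihf (2 ^ n - tableOp n b c) (by omega) _ (by omega) (by omega) _
          (by omega), ihc, tableOp_succ ha hb, tableOp_succ ha hc,
          ihd (2 ^ n - tableOp n a b) (by omega) (tableOp n a b) (by omega)
            (2 ^ n - tableOp n a c) (tableOp n a c) (by omega) (by omega) (a + 1) (by omega)]

theorem tableOp_ld {n a b c : ℕ} (ha : a ≤ 2 ^ n) (hb : 1 ≤ b) (hb' : b ≤ 2 ^ n) (hc : 1 ≤ c) :
    tableOp n a (tableOp n b c) = tableOp n (tableOp n a b) (tableOp n a c) :=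
  tableOp_distrib n (2 ^ n - a) a (by omega) (2 ^ n - b) b (by omega) hb c hc

/-- The projection from `{1, …, 2^(n+1)}` to `{1, …, 2^n}`. -/
def proj (n a : ℕ) : ℕ := if a ≤ 2 ^ n then a else a - 2 ^ n

theorem proj_tableOp {n a b : ℕ} (ha : a ≤ 2 ^ (n + 1)) (hb : 1 ≤ b) (hb' : b ≤ 2 ^ (n + 1)) :
    proj n (tableOp (n + 1) a b) = tableOp n (proj n a) (proj n b) := by
  have hpow : 2 ^ (n + 1) = 2 ^ n + 2 ^ n := by ring
  have hpos : 0 < 2 ^ n := by positivity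
  have H := topColumn n
  have hrow : ∀ c < 2 ^ n, tableOp n c (proj n b) = tableOp n c b := by
    intro c hc
    unfold proj
    split_ifs with h
    · rfl
    · conv_rhs => rw [show b = 2 ^ n + (b - 2 ^ n) by omega, H.add hc (by omega)]
  have hbp : 1 ≤ proj n b ∧ proj n b ≤ 2 ^ n := by unfold proj; split_ifs <;> omega
  rcases lt_trichotomy a (2 ^ n) with h | rfl | h
  · rw [show proj n a = a by simp [proj, h.le], hrow a h]
    have h1 := tableOp_lt h hb
    have h2 := tableOp_le h hb
    rcases H.lower (2 ^ n - a) a (by omega) (by omega) b hb with e | e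
    · rw [e]; simp [proj, h2]
    · rw [e]; unfold proj; split_ifs <;> omega
  · have e := H.upper (2 ^ n) 0 (by omega) hpos b hb
    rw [add_zero] at e
    have h1 := tableOp_lt hpos hb
    rw [e, ← hrow 0 hpos, show proj n (2 ^ n) = 2 ^ n by simp [proj], tableOp_top,
      tableOp_zero hbp.1 hbp.2]
    generalize proj n b = c at *
    unfold proj; split_ifs <;> omega
  · rcases ha.eq_or_lt with rfl | h'
    · rw [tableOp_top, show proj n (2 ^ (n + 1)) = 2 ^ n by unfold proj; split_ifs <;> omega,
        tableOp_top]
    · obtain ⟨c, rfl⟩ := Nat.exists_eq_add_of_le h.le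
      have e := H.upper (2 ^ n - c) c (by omega) (by omega) b hb
      have hc : c < 2 ^ n := by omega
      have h1 := tableOp_lt hc hb
      rw [e, show proj n (2 ^ n + c) = c by unfold proj; split_ifs <;> omega, hrow c hc]
      unfold proj; split_ifs <;> omega

/-- Periods at most double from one table to the next. -/
theorem tableOp_double {n a p : ℕ} (ha : a ≤ 2 ^ (n + 1)) (hp : 1 ≤ p) (hp' : p ≤ 2 ^ n)
    (h : tableOp n (proj n a) p = 2 ^ n) : tableOp (n + 1) a (2 * p) = 2 ^ (n + 1) := by
  have hpow : 2 ^ (n + 1) = 2 ^ n + 2 ^ n := by ring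
  have hpos : 0 < 2 ^ n := by positivity
  have H := topColumn n
  have hup : ∀ c < 2 ^ n, tableOp n c p = 2 ^ n →
      tableOp (n + 1) (2 ^ n + c) (2 * p) = 2 ^ (n + 1) := by
    intro c hc e
    rw [H.upper (2 ^ n - c) c (by omega) (by omega) _ (by omega), mul_comm,
      tableOp_mul_period hc hp e (by omega), hpow]
  rcases lt_trichotomy a (2 ^ n) with h' | rfl | h'
  · rw [show proj n a = a by simp [proj, h'.le]] at h
    exact H.double h' hp h
  · rw [show proj n (2 ^ n) = 2 ^ n by simp [proj], tableOp_top] at h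
    simpa using hup 0 hpos (by rw [tableOp_zero hp hp', h])
  · rcases ha.eq_or_lt with rfl | h''
    · rw [show proj n (2 ^ (n + 1)) = 2 ^ n by unfold proj; split_ifs <;> omega, tableOp_top] at h
      rw [tableOp_top]; omega
    · obtain ⟨c, rfl⟩ := Nat.exists_eq_add_of_le h'.le
      rw [show proj n (2 ^ n + c) = c by unfold proj; split_ifs <;> omega] at h
      exact hup c (by omega) h

end EmbAlg

namespace EmbAlg

/-! ### Words in the tables -/

/-- The value of a word in `{1, …, 2^n}`. -/
def Word.val (n : ℕ) (w : Word) : ℕ := (w.eval Table.op (Table.one n)).1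

namespace Word

theorem val_gen (n : ℕ) : (gen).val n = 1 := rfl

theorem val_app (n : ℕ) (k l : Word) : (app k l).val n = tableOp n (k.val n) (l.val n) := rfl

theorem one_le_val (n : ℕ) (w : Word) : 1 ≤ w.val n := (w.eval Table.op (Table.one n)).2.1

theorem val_le (n : ℕ) (w : Word) : w.val n ≤ 2 ^ n := (w.eval Table.op (Table.one n)).2.2

theorem finCritGE_iff {w : Word} {n : ℕ} : FinCritGE w n ↔ w.val n = 2 ^ n := by
  have h1 := one_le_val n w
  have h2 := val_le n w
  change w.val n % 2 ^ n = 0 ↔ _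
  rcases h2.eq_or_lt with h | h
  · simp [h]
  · rw [Nat.mod_eq_of_lt h]; omega

theorem proj_val (n : ℕ) (w : Word) : proj n (w.val (n + 1)) = w.val n := by
  induction w with
  | gen => simp [val_gen, proj, Nat.one_le_two_pow]
  | app k l hk hl =>
    rw [val_app, proj_tableOp (val_le _ _) (one_le_val _ _) (val_le _ _), hk, hl, val_app]

theorem val_mod_two_pow {s r : ℕ} (h : s ≤ r) (w : Word) : w.val r ≡ w.val s [MOD 2 ^ s] := by
  induction r, h using Nat.le_induction with
  | base => rfl
  | succ r h ih =>
    refine Nat.ModEq.trans ?_ ih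
    rw [← proj_val r w]
    refine Nat.ModEq.of_dvd (pow_dvd_pow 2 h) ?_
    unfold proj
    split_ifs with h'
    · rfl
    · conv_lhs => rw [← Nat.sub_add_cancel (not_le.1 h').le]
      simp [Nat.ModEq]

theorem finCritGE_iff_dvd {s r : ℕ} (h : s ≤ r) {w : Word} :
    FinCritGE w s ↔ 2 ^ s ∣ w.val r := by
  rw [← Nat.modEq_zero_iff_dvd]
  change w.val s % 2 ^ s = 0 ↔ _
  have := val_mod_two_pow h w
  unfold Nat.ModEq at *
  rw [this]; simp

theorem finCritGE_zero (w : Word) : FinCritGE w 0 := (finCritGE_iff_dvd le_rfl).2 (by simp)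

theorem _root_.EmbAlg.FinCritGE.mono {s r : ℕ} {w : Word} (h : FinCritGE w r) (hs : s ≤ r) :
    FinCritGE w s := by
  rw [finCritGE_iff_dvd hs, finCritGE_iff.1 h]
  exact pow_dvd_pow 2 hs

theorem val_leftPow (n : ℕ) (m : ℕ) : (leftPow (m + 1)).val n = tableOp n 0 (m + 1) := by
  induction m with
  | zero => rw [tableOp_one (by positivity)]; rfl
  | succ m ih =>
    rw [tableOp_succ (by positivity) (by omega), ← ih]; rfl

theorem val_leftPow_of_le {n m : ℕ} (hm : 1 ≤ m) (hm' : m ≤ 2 ^ n) :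
    (leftPow m).val n = m := by
  obtain ⟨m, rfl⟩ := Nat.exists_eq_add_of_le' hm
  rw [val_leftPow, tableOp_zero hm hm']

theorem val_leftPow_two_pow {n s : ℕ} (h : n ≤ s) : (leftPow (2 ^ s)).val n = 2 ^ n := by
  obtain ⟨m, hm⟩ := Nat.exists_eq_add_of_le' (Nat.one_le_two_pow (n := s))
  rw [hm, val_leftPow, ← hm, ← Nat.add_sub_cancel' h, pow_add]
  exact tableOp_mul_period (by positivity) Nat.one_le_two_pow (tableOp_two_pow (by positivity))
    Nat.one_le_two_pow

open Classical in
/-- The index of the critical point of a word, `⊤` if the word vanishes in all tables. -/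
noncomputable def crit (k : Word) : ℕ∞ :=
  if h : ∃ r, ¬ FinCritGE k r then ((Nat.find h - 1 : ℕ) : ℕ∞) else ⊤

theorem natCast_le_crit {k : Word} {r : ℕ} : (r : ℕ∞) ≤ k.crit ↔ FinCritGE k r := by
  classical
  unfold crit
  split_ifs with h
  · have h0 : Nat.find h ≠ 0 := fun e => (e ▸ Nat.find_spec h) (finCritGE_zero k)
    rw [Nat.cast_le]
    constructor
    · intro hr
      exact not_not.1 (Nat.find_min h (show r < Nat.find h by omega))
    · intro hr
      by_contra hlt
      exact Nat.find_spec h (hr.mono (by omega))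
  · push Not at h
    simpa using h r

theorem isGreatest_crit_iff {k : Word} {r : ℕ} :
    IsGreatest {r | FinCritGE k r} r ↔ k.crit = r := by
  simp only [← natCast_le_crit]
  constructor
  · rintro ⟨h1, h2⟩
    refine ENat.eq_of_forall_natCast_le_iff fun a => ⟨fun h => ?_, fun h => ?_⟩
    · exact_mod_cast h2 h
    · exact h.trans h1
  · intro h
    rw [h]
    exact ⟨le_refl (r : ℕ∞), fun a ha => by simpa using ha⟩

/-- The action of a word on the indices of critical points. -/
noncomputable def ap (k : Word) (x : ℕ∞) : ℕ∞ :=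
  ENat.recTopCoe ⊤ (fun s => (app k (leftPow (2 ^ s))).crit) x

@[simp] theorem ap_top (k : Word) : k.ap ⊤ = ⊤ := rfl

theorem ap_natCast (k : Word) (s : ℕ) : k.ap s = (app k (leftPow (2 ^ s))).crit := rfl

theorem natCast_le_ap {k : Word} {s r : ℕ} : (r : ℕ∞) ≤ k.ap s ↔ FinApplyGE k s r :=
  natCast_le_crit

/-- The condition `s ≤ r` ensures that j_(2^s) has the value 2^s itself in the r-th table. -/
theorem natCast_le_ap_iff {k : Word} {s r : ℕ} (h : s ≤ r) :
    (r : ℕ∞) ≤ k.ap s ↔ tableOp r (k.val r) (2 ^ s) = 2 ^ r := by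
  rw [natCast_le_ap, FinApplyGE, finCritGE_iff, val_app,
    val_leftPow_of_le Nat.one_le_two_pow (Nat.pow_le_pow_right (by norm_num) h)]

theorem natCast_le_ap_of_le {k : Word} {s r : ℕ} (h : r ≤ s) : (r : ℕ∞) ≤ k.ap s := by
  rw [natCast_le_ap, FinApplyGE, finCritGE_iff, val_app, val_leftPow_two_pow h,
    tableOp_two_pow (val_le _ _)]

theorem le_ap (k : Word) (x : ℕ∞) : x ≤ k.ap x := by
  induction x using ENat.recTopCoe with
  | top => simp
  | coe s => exact natCast_le_ap_of_le le_rfl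

/-- In the r-th table the row of `k` takes its top value exactly at the multiples of some 2^q. So
only the power of two dividing the value of `l` matters, and `l` may be replaced by j_(2^s) with s =
crit l. -/
theorem crit_app (k l : Word) : (app k l).crit = k.ap l.crit := by
  refine ENat.eq_of_forall_natCast_le_iff fun r => ?_
  have key : ∀ s : ℕ, l.crit = s → ((r : ℕ∞) ≤ (app k l).crit ↔ (r : ℕ∞) ≤ k.ap s) := by
    intro s hs
    rcases le_or_gt r s with h | h
    · refine iff_of_true ?_ (natCast_le_ap_of_le h)
      have : FinCritGE l r := natCast_le_crit.1 (by rw [hs]; exact_mod_cast h)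
      rw [natCast_le_crit, finCritGE_iff, val_app, finCritGE_iff.1 this,
        tableOp_two_pow (val_le _ _)]
    · have h1 : 2 ^ s ∣ l.val r := (finCritGE_iff_dvd h.le).1 (natCast_le_crit.1 hs.ge)
      have h2 : ¬ 2 ^ (s + 1) ∣ l.val r := by
        rw [← finCritGE_iff_dvd h, ← natCast_le_crit, hs]
        norm_cast; omega
      obtain ⟨q, -, hq⟩ := exists_two_pow_period (val_le r k)
      rw [natCast_le_ap_iff h.le, natCast_le_crit, finCritGE_iff, val_app,
        hq _ (one_le_val _ _) (val_le _ _),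
        hq _ Nat.one_le_two_pow (Nat.pow_le_pow_right (by norm_num) h.le),
        Nat.pow_dvd_pow_iff_le_right (by norm_num)]
      constructor
      · intro hd
        by_contra hlt
        exact h2 ((pow_dvd_pow 2 (by omega)).trans hd)
      · intro hd
        exact (pow_dvd_pow 2 hd).trans h1
  rcases eq_or_ne l.crit ⊤ with hc | hc
  · refine iff_of_true ?_ (by simp [hc])
    have : FinCritGE l r := natCast_le_crit.1 (by rw [hc]; simp)
    rw [natCast_le_crit, finCritGE_iff, val_app, finCritGE_iff.1 this,
      tableOp_two_pow (val_le _ _)]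
  · obtain ⟨s, hs⟩ := ENat.ne_top_iff_exists.1 hc
    rw [← hs]
    exact key s hs.symm

theorem crit_congr {k l : Word} (h : ∀ n, k.val n = l.val n) : k.crit = l.crit :=
  ENat.eq_of_forall_natCast_le_iff fun r => by simp only [natCast_le_crit, finCritGE_iff, h]

theorem ap_ap (k l : Word) (x : ℕ∞) : k.ap (l.ap x) = (app k l).ap (k.ap x) := by
  induction x using ENat.recTopCoe with
  | top => simp
  | coe s =>
    rw [ap_natCast, ap_natCast, ← crit_app, ← crit_app]
    exact crit_congr fun n => tableOp_ld (val_le _ _) (one_le_val _ _) (val_le _ _) (one_le_val _ _)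

/-- This is strict monotonicity on indices; it holds because periods at most double from one table
to the next. -/
theorem ap_add_one_le (k : Word) (s : ℕ) : k.ap s + 1 ≤ k.ap (s + 1 : ℕ) := by
  rw [← ENat.forall_natCast_le_iff_le]
  intro a ha
  rcases le_or_gt a (s + 1) with h | h
  · exact natCast_le_ap_of_le h
  obtain ⟨r, rfl⟩ : ∃ r, a = r + 1 := ⟨a - 1, by omega⟩
  have hr : (r : ℕ∞) ≤ k.ap s := by
    push_cast at ha
    exact (ENat.add_le_add_iff_right (by simp)).1 ha
  rw [natCast_le_ap_iff (by omega)] at hr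
  rw [natCast_le_ap_iff h.le, pow_succ' 2 s]
  exact tableOp_double (val_le _ _) Nat.one_le_two_pow
    (Nat.pow_le_pow_right (by norm_num) (by omega)) (by rw [proj_val, hr])

theorem ap_add_le (k : Word) (s d : ℕ) : k.ap s + d ≤ k.ap (s + d : ℕ) := by
  induction d with
  | zero => simp
  | succ d ih =>
    calc k.ap s + (d + 1 : ℕ) = (k.ap s + d) + 1 := by push_cast; ring
      _ ≤ k.ap (s + d : ℕ) + 1 := by gcongr
      _ ≤ _ := ap_add_one_le k (s + d)

theorem ap_mono (k : Word) : Monotone k.ap := by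
  intro x y h
  induction y using ENat.recTopCoe with
  | top => simp
  | coe t =>
    lift x to ℕ using ne_top_of_le_ne_top (by simp) h
    obtain ⟨d, rfl⟩ := Nat.exists_eq_add_of_le (Nat.cast_le.1 h)
    exact le_self_add.trans (ap_add_le k x d)

theorem ap_of_lt_crit {k : Word} {s : ℕ} (h : (s : ℕ∞) < k.crit) : k.ap s = s := by
  refine le_antisymm (le_of_not_gt fun hlt => ?_) (le_ap k s)
  rw [← ENat.natCast_add_one_le_iff] at h hlt
  have h1 := finCritGE_iff.1 (natCast_le_crit.1 (by exact_mod_cast h : ((s + 1 : ℕ) : ℕ∞) ≤ _))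
  have h2 := (natCast_le_ap_iff (Nat.le_succ s)).1
    (by exact_mod_cast hlt : ((s + 1 : ℕ) : ℕ∞) ≤ _)
  rw [h1, tableOp_top] at h2
  exact absurd h2 (Nat.pow_lt_pow_right (by norm_num) (by omega)).ne

theorem add_one_le_ap {k : Word} {s : ℕ} (h : k.crit ≤ s) : ((s + 1 : ℕ) : ℕ∞) ≤ k.ap s := by
  obtain ⟨c, hc⟩ := ENat.ne_top_iff_exists.1 (ne_top_of_le_ne_top (by simp) h)
  have hcs : c ≤ s := by rw [← hc] at h; exact_mod_cast h
  obtain ⟨d, rfl⟩ := Nat.exists_eq_add_of_le hcs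
  -- At the critical index itself: `k` has value 2^c in the table of size 2^(c+1), and there 2^c *
  -- 2^c = 2^(c+1). Strict monotonicity then covers larger indices.
  have key : ((c + 1 : ℕ) : ℕ∞) ≤ k.ap c := by
    have h1 : 2 ^ c ∣ k.val (c + 1) := (finCritGE_iff_dvd (by omega)).1 (natCast_le_crit.1 hc.le)
    have h2 : k.val (c + 1) ≠ 2 ^ (c + 1) := by
      rw [Ne, ← finCritGE_iff, ← natCast_le_crit, ← hc]
      norm_cast; omega
    have h3 := one_le_val (c + 1) k
    have h4 := val_le (c + 1) k
    have h5 : k.val (c + 1) = 2 ^ c := by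
      obtain ⟨t, ht⟩ := h1
      rw [ht] at h2 h3 h4 ⊢
      have hp : 0 < 2 ^ c := by positivity
      rw [pow_succ] at h2 h4
      have := Nat.le_of_mul_le_mul_left h4 hp
      interval_cases t <;> simp_all
    rw [natCast_le_ap_iff (by omega), h5]
    have := (topColumn c).upper (2 ^ c) 0 (by simp) (by positivity) (2 ^ c) Nat.one_le_two_pow
    rw [add_zero, topColumn c 0 (by positivity)] at this
    rw [this]; ring
  calc ((c + d + 1 : ℕ) : ℕ∞) = (c + 1 : ℕ) + d := by push_cast; ring
    _ ≤ k.ap c + d := by gcongr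
    _ ≤ _ := ap_add_le k c d

theorem val_lt_val_app {k : Word} {r : ℕ} (h : k.crit < r) (l : Word) :
    k.val r < (app k l).val r := by
  refine tableOp_lt (lt_of_le_of_ne (val_le r k) ?_) (one_le_val r l)
  rw [Ne, ← finCritGE_iff, ← natCast_le_crit]
  exact not_le.2 h

end Word

end EmbAlg

namespace EmbAlg

open Word

/-! ### The theorem for the finite algebras -/

/-- There are words whose critical sequences run through `2^n - 2^(m+1)`, `2^n - 2^m`, `2^n`. -/
def Ladder (n : ℕ) : Prop :=
  ∀ m < n, ∃ κ : Word, κ.crit = (2 ^ n - 2 ^ (m + 1) : ℕ) ∧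
    κ.ap (2 ^ n - 2 ^ (m + 1) : ℕ) = (2 ^ n - 2 ^ m : ℕ) ∧ κ.ap (2 ^ n - 2 ^ m : ℕ) = (2 ^ n : ℕ)

/-- The word maps index `M` to at least `2 M`, with equality only if its value in the table of
size `2^(2 M)` is less than `2^M`. -/
def Doubles (M : ℕ) (k : Word) : Prop :=
  ((2 * M : ℕ) : ℕ∞) ≤ k.ap M ∧ (k.ap M ≤ (2 * M : ℕ) → k.val (2 * M) < 2 ^ M)

/-- Values grow along a row, so an upper bound on the value of kl is also one for `k`. -/
theorem Doubles.of_app {M : ℕ} {k l : Word} (hk : k.crit < M) (h : Doubles M (.app k l))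
    (hle : (Word.app k l).ap M ≤ k.ap M) : Doubles M k := by
  refine ⟨h.1.trans hle, fun h2 => lt_trans (val_lt_val_app ?_ l) (h.2 (hle.trans h2))⟩
  exact hk.trans_le (by exact_mod_cast (by omega : M ≤ 2 * M))

theorem doubles_of_crit_eq_zero {M : ℕ} (hM : 1 ≤ M) {k : Word} (hk : k.crit = 0)
    (h : (M : ℕ∞) ≤ k.ap (0 : ℕ)) : Doubles M k := by
  refine ⟨?_, fun hle => ?_⟩
  · calc ((2 * M : ℕ) : ℕ∞) = M + M := by push_cast; ring
      _ ≤ k.ap (0 : ℕ) + M := by gcongr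
      _ ≤ k.ap (0 + M : ℕ) := ap_add_le k 0 M
      _ = k.ap M := by rw [zero_add]
  set a := k.val (2 * M) with ha
  have hpow : 2 ^ (2 * M) = 2 ^ M * 2 ^ M := by rw [two_mul, pow_add]
  have hMM : 2 ^ M ≤ 2 ^ (2 * M) := Nat.pow_le_pow_right (by norm_num) (by omega)
  have hlt : a < 2 ^ (2 * M) := by
    refine lt_of_le_of_ne (val_le _ k) ?_
    rw [ha, Ne, ← finCritGE_iff, ← natCast_le_crit, hk]
    simp
    omega
  -- Every critical index is at least 0, so crit(kl) = k(crit l) ≥ k(0) ≥ M for all `l`.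
  have hdvd : ∀ i, 1 ≤ i → i ≤ 2 ^ (2 * M) → 2 ^ M ∣ tableOp (2 * M) a i := by
    intro i hi hi'
    have h1 : FinCritGE (.app k (.leftPow i)) M := by
      rw [← natCast_le_crit, crit_app]
      exact h.trans (ap_mono k (by simp))
    have h2 := (finCritGE_iff_dvd (by omega : M ≤ 2 * M)).1 h1
    rwa [val_app, val_leftPow_of_le hi hi'] at h2
  obtain ⟨q, -, hq⟩ := exists_two_pow_period hlt.le
  -- A smaller period would give k(M - 1) ≥ 2M and hence k(M) > 2M.
  have hqM : M ≤ q := by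
    by_contra hc
    have h1 : ((2 * M : ℕ) : ℕ∞) ≤ k.ap (M - 1 : ℕ) := by
      rw [natCast_le_ap_iff (by omega), hq _ Nat.one_le_two_pow
        (Nat.pow_le_pow_right (by norm_num) (by omega))]
      exact pow_dvd_pow 2 (by omega)
    have h2 := (add_le_add h1 le_rfl).trans (ap_add_one_le k (M - 1))
    rw [Nat.sub_add_cancel hM] at h2
    replace h2 := h2.trans hle
    norm_cast at h2
    omega
  -- Up to the period the entries are strictly increasing multiples of 2^M, so each step adds at
  -- least 2^M. At i = 2^M this leaves room only for a + 1 ≤ 2^M.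
  have hgrow : ∀ i, 1 ≤ i → i ≤ 2 ^ M → a + 1 + (i - 1) * 2 ^ M ≤ tableOp (2 * M) a i := by
    intro i hi
    induction i, hi using Nat.le_induction with
    | base => intro _; rw [tableOp_one hlt]; simp
    | succ i hi ih =>
      intro hi'
      have h1 := ih (by omega)
      have h2 : tableOp (2 * M) a i < 2 ^ (2 * M) := by
        refine lt_of_le_of_ne (tableOp_le hlt hi) fun e => ?_
        have := Nat.le_of_dvd hi ((pow_dvd_pow 2 hqM).trans ((hq i hi (by omega)).1 e))
        omega
      have h3 : tableOp (2 * M) a i < tableOp (2 * M) a (i + 1) := by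
        rw [tableOp_succ hlt hi]; exact tableOp_lt h2 (by omega)
      obtain ⟨x, hx⟩ := hdvd i hi (by omega)
      obtain ⟨y, hy⟩ := hdvd (i + 1) (by omega) (by omega)
      rw [hx] at h1
      rw [hx, hy] at h3
      have h4 := Nat.lt_of_mul_lt_mul_left h3
      have h5 : 2 ^ M * (x + 1) ≤ 2 ^ M * y := Nat.mul_le_mul_left _ h4
      rw [hy]
      obtain ⟨i, rfl⟩ : ∃ i', i = i' + 1 := ⟨i - 1, by omega⟩
      simp only [Nat.add_sub_cancel] at h1 ⊢
      linarith
  have h1 := (hgrow (2 ^ M) Nat.one_le_two_pow le_rfl).trans (tableOp_le hlt Nat.one_le_two_pow)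
  rw [hpow, Nat.sub_mul, one_mul] at h1
  have h2 : 2 ^ M ≤ 2 ^ M * 2 ^ M := Nat.le_mul_of_pos_left _ (by positivity)
  omega

/-- Descend the ladder to critical index 0. With κ : 2^n - 2^(m+1) ↦ 2^n - 2^m ↦ 2^n, the word kκ
satisfies the hypotheses one rung lower, since `k` fixes 2^n - 2^(m+1). Moreover (kκ)(2^n) ≤
(kκ)(k(2^n - 2^m)) = k(2^n). -/
theorem Ladder.doubles_of_le {n : ℕ} (hL : Ladder n) {m : ℕ} (hm : m ≤ n) :
    ∀ k : Word, k.crit = (2 ^ n - 2 ^ m : ℕ) → ((2 ^ n : ℕ) : ℕ∞) ≤ k.ap (2 ^ n - 2 ^ m : ℕ) →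
      Doubles (2 ^ n) k := by
  induction hm using Nat.decreasingInduction with
  | self =>
    intro k hk h
    rw [Nat.sub_self] at hk h
    exact doubles_of_crit_eq_zero Nat.one_le_two_pow (by simpa using hk) h
  | of_succ m hm ih =>
    intro k hk h
    obtain ⟨κ, h1, h2, h3⟩ := hL m hm
    have hp : 2 ^ (m + 1) ≤ 2 ^ n := Nat.pow_le_pow_right (by norm_num) hm
    have hp' : 2 ^ (m + 1) = 2 ^ m + 2 ^ m := by ring
    have hp0 : 0 < 2 ^ m := by positivity
    have e1 : k.ap (2 ^ n - 2 ^ (m + 1) : ℕ) = (2 ^ n - 2 ^ (m + 1) : ℕ) :=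
      ap_of_lt_crit (by rw [hk]; norm_cast; omega)
    refine Doubles.of_app (l := κ) (by rw [hk]; norm_cast; omega) (ih _ ?_ ?_) ?_
    · rw [crit_app, h1, e1]
    · have := ap_ap k κ (2 ^ n - 2 ^ (m + 1) : ℕ)
      rw [e1, h2] at this
      rwa [← this]
    · have := ap_ap k κ (2 ^ n - 2 ^ m : ℕ)
      rw [h3] at this
      rw [this]
      exact ap_mono _ h

/-- A word with critical index less than `2^n` maps index `2^n` to at least `2^(n+1)`. -/
theorem Ladder.doubles {n : ℕ} (hL : Ladder n) : ∀ (d r : ℕ), r + d = 2 ^ n → 0 < d →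
    ∀ k : Word, k.crit = r → Doubles (2 ^ n) k := by
  intro d
  induction d using Nat.strong_induction_on with
  | _ d ih =>
    intro r hrd hd k hk
    have hkM : k.crit < (2 ^ n : ℕ) := by rw [hk]; norm_cast; omega
    by_contra hQ
    -- For a counterexample `k`, every rung at or above crit k must be sent to at least 2^n.
    -- Otherwise kκ, whose critical index c lies strictly between r and 2^n, is covered by the
    -- induction hypothesis, and the conclusion passes back to `k`.
    have hstep : ∀ i, r ≤ 2 ^ n - 2 ^ i → 2 ^ i ≤ 2 ^ n →
        ((2 ^ n : ℕ) : ℕ∞) ≤ k.ap (2 ^ n - 2 ^ i : ℕ) := by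
      intro i
      induction i with
      | zero =>
        intro h _
        have := add_one_le_ap (k := k) (s := 2 ^ n - 2 ^ 0) (by rw [hk]; exact_mod_cast h)
        rwa [pow_zero, Nat.sub_add_cancel Nat.one_le_two_pow] at this
      | succ i ihi =>
        intro h h'
        have hi : i < n := (Nat.pow_le_pow_iff_right (by norm_num)).1 h'
        have hp' : 2 ^ (i + 1) = 2 ^ i + 2 ^ i := by ring
        obtain ⟨κ, h1, h2, h3⟩ := hL i hi
        have hge := ihi (by omega) (by omega)
        by_contra hlt
        rw [not_le] at hlt
        obtain ⟨c, hc⟩ := ENat.ne_top_iff_exists.1 (hlt.trans_le le_top).ne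
        have hc1 := add_one_le_ap (k := k) (s := 2 ^ n - 2 ^ (i + 1))
          (by rw [hk]; exact_mod_cast h)
        rw [← hc] at hlt hc1
        norm_cast at hlt hc1
        refine hQ (Doubles.of_app (l := κ) hkM
          (ih (2 ^ n - c) (by omega) c (by omega) (by omega) _ ?_) ?_)
        · rw [crit_app, h1, hc]
        · have := ap_ap k κ (2 ^ n - 2 ^ i : ℕ)
          rw [h3] at this
          rw [this]
          exact ap_mono _ hge
    have hex : ∃ m, 2 ^ n - 2 ^ m ≤ r := ⟨n, by simp⟩
    classical
    have hm := Nat.find_spec hex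
    have hmin := fun i => Nat.find_min hex (m := i)
    have hmn : Nat.find hex ≤ n := Nat.find_min' hex (by simp)
    generalize Nat.find hex = m at hm hmin hmn
    have hpm : 2 ^ m ≤ 2 ^ n := Nat.pow_le_pow_right (by norm_num) hmn
    rcases hm.eq_or_lt with h | h
    · exact hQ (hL.doubles_of_le hmn k (by rw [hk, h]) (hstep m h.ge hpm))
    -- Here crit k lies strictly between two rungs; `k` fixes the lower one, so kκ has its critical
    -- point there and sends it to at least 2^n.
    · obtain ⟨i, rfl⟩ : ∃ i, m = i + 1 := by
        rcases m with _ | i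
        · simp at h; omega
        · exact ⟨i, rfl⟩
      have hi := hmin i (by omega)
      have hp' : 2 ^ (i + 1) = 2 ^ i + 2 ^ i := by ring
      have hge := hstep i (by omega) (by omega)
      obtain ⟨κ, h1, h2, h3⟩ := hL i (by omega)
      have e1 : k.ap (2 ^ n - 2 ^ (i + 1) : ℕ) = (2 ^ n - 2 ^ (i + 1) : ℕ) :=
        ap_of_lt_crit (by rw [hk]; exact_mod_cast h)
      refine hQ (Doubles.of_app (l := κ) hkM (hL.doubles_of_le hmn _ ?_ ?_) ?_)
      · rw [crit_app, h1, e1]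
      · have := ap_ap k κ (2 ^ n - 2 ^ (i + 1) : ℕ)
        rw [e1, h2] at this
        rwa [← this]
      · have := ap_ap k κ (2 ^ n - 2 ^ i : ℕ)
        rw [h3] at this
        rw [this]
        exact ap_mono _ hge

theorem Ladder.doubles_of_lt {n : ℕ} (hL : Ladder n) {k : Word} (hk : k.crit < (2 ^ n : ℕ)) :
    Doubles (2 ^ n) k := by
  obtain ⟨r, hr⟩ := ENat.ne_top_iff_exists.1 (hk.trans_le le_top).ne
  rw [← hr] at hk
  norm_cast at hk
  exact hL.doubles (2 ^ n - r) r (by omega) (by omega) k hr.symm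

/-- Almost all rows of the table of size `2^(2 M + 1)` have period at most `2^M`. -/
theorem Ladder.tableOp_two_pow_eq {n M a : ℕ} (hL : Ladder n) (hM : M = 2 ^ n) (ha : 2 ^ M ≤ a)
    (ha' : a ≤ 2 ^ (2 * M)) (hd : ¬ 2 ^ M ∣ a) :
    tableOp (2 * M + 1) a (2 ^ M) = 2 ^ (2 * M + 1) := by
  have hpos : 1 ≤ a := Nat.one_le_two_pow.trans ha
  have hR : a ≤ 2 ^ (2 * M + 1) := ha'.trans (Nat.pow_le_pow_right (by norm_num) (by omega))
  have hk : (leftPow a).crit < M := by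
    rw [← not_le, natCast_le_crit, finCritGE_iff_dvd (by omega : M ≤ 2 * M),
      val_leftPow_of_le hpos ha']
    exact hd
  subst hM
  have h1 := (hL.doubles_of_lt hk).2
  rw [val_leftPow_of_le hpos ha'] at h1
  have h2 := lt_of_not_ge fun h => (h1 h).not_ge ha
  rw [← ENat.natCast_add_one_le_iff] at h2
  have h3 := (natCast_le_ap_iff (s := 2 ^ n) (r := 2 * 2 ^ n + 1) (by omega)).1
    (by exact_mod_cast h2 : ((2 * 2 ^ n + 1 : ℕ) : ℕ∞) ≤ _)
  rwa [val_leftPow_of_le hpos hR] at h3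

/-- The next entry is (2^M c + i) * (2^M c + 1), and the period of that row divides 2^M, so it
equals (2^M c + i) * 1. -/
theorem Ladder.tableOp_add {n M c : ℕ} (hL : Ladder n) (hM : M = 2 ^ n) (hc : 1 ≤ c)
    (hc' : c < 2 ^ M) {i : ℕ} (hi : 1 ≤ i) (hi' : i ≤ 2 ^ M) :
    tableOp (2 * M + 1) (2 ^ M * c) i = 2 ^ M * c + i := by
  have hpow : 2 ^ (2 * M) = 2 ^ M * 2 ^ M := by rw [two_mul, pow_add]
  have hpow1 : 2 ^ (2 * M + 1) = 2 ^ (2 * M) + 2 ^ (2 * M) := by ring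
  have hle : 2 ^ M * (c + 1) ≤ 2 ^ M * 2 ^ M := Nat.mul_le_mul_left _ hc'
  have hge : 2 ^ M * 1 ≤ 2 ^ M * c := Nat.mul_le_mul_left _ hc
  have hpos : 0 < 2 ^ M := by positivity
  rw [mul_add] at hle
  induction i, hi using Nat.le_induction with
  | base => rw [tableOp_one (by omega)]
  | succ i hi ih =>
    have hper : tableOp (2 * M + 1) (2 ^ M * c + i) (2 ^ M) = 2 ^ (2 * M + 1) := by
      refine hL.tableOp_two_pow_eq hM (by omega) (by omega) fun hd => ?_
      have := Nat.le_of_dvd (by omega) ((Nat.dvd_add_right (dvd_mul_right _ _)).1 hd)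
      omega
    rw [tableOp_succ (by omega) hi, ih (by omega),
      tableOp_mul_period_add (by omega) hpos hper c le_rfl, tableOp_one (by omega), add_assoc]

/-- The next entry is (2^M i) * 2^M, which `Ladder.tableOp_add` evaluates as 2^M i + 2^M. -/
theorem Ladder.tableOp_pred {n M : ℕ} (hL : Ladder n) (hM : M = 2 ^ n) {i : ℕ} (hi : 1 ≤ i)
    (hi' : i ≤ 2 ^ M) : tableOp (2 * M + 1) (2 ^ M - 1) i = 2 ^ M * i := by
  have hlt : 2 ^ M < 2 ^ (2 * M + 1) := Nat.pow_lt_pow_right (by norm_num) (by omega)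
  have hpos : 0 < 2 ^ M := by positivity
  induction i, hi using Nat.le_induction with
  | base => rw [tableOp_one (by omega)]; omega
  | succ i hi ih =>
    rw [tableOp_succ (by omega) hi, ih (by omega), Nat.sub_add_cancel hpos,
      hL.tableOp_add hM hi (by omega) hpos le_rfl]
    ring

/-! ### The word j_(2^M - 1) and the induction step -/

theorem crit_leftPow_pred {M : ℕ} (hM : 1 ≤ M) : (leftPow (2 ^ M - 1)).crit = (0 : ℕ) := by
  rw [← isGreatest_crit_iff]
  refine ⟨finCritGE_zero _, fun r hr => ?_⟩
  by_contra h0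
  have h1 : 2 ^ 1 ≤ 2 ^ M := Nat.pow_le_pow_right (by norm_num) hM
  have h2 := (finCritGE_iff_dvd hM).1 (FinCritGE.mono hr (by omega : 1 ≤ r))
  rw [val_leftPow_of_le (by omega) (by omega)] at h2
  have h3 : 2 ^ 1 ∣ 2 ^ M := pow_dvd_pow 2 hM
  omega

theorem ap_leftPow_pred_zero {M : ℕ} (hM : 1 ≤ M) :
    (leftPow (2 ^ M - 1)).ap (0 : ℕ) = M := by
  have h1 : 2 ^ 1 ≤ 2 ^ M := Nat.pow_le_pow_right (by norm_num) hM
  have hpow1 : 2 ^ (M + 1) = 2 ^ M + 2 ^ M := by ring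
  refine le_antisymm (le_of_not_gt fun h => ?_) ?_
  · rw [← ENat.natCast_add_one_le_iff] at h
    have h2 := (natCast_le_ap_iff (s := 0) (r := M + 1) (by omega)).1 (by exact_mod_cast h : ((M + 1 : ℕ) : ℕ∞) ≤ _)
    rw [val_leftPow_of_le (by omega) (by omega), pow_zero, tableOp_one (by omega)] at h2
    omega
  · rw [natCast_le_ap_iff (by omega), val_leftPow_of_le (by omega) (by omega), pow_zero,
      tableOp_one (by omega)]
    omega

theorem Ladder.ap_leftPow_pred {n M : ℕ} (hL : Ladder n) (hM : M = 2 ^ n) :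
    (leftPow (2 ^ M - 1)).ap M = (2 * M : ℕ) := by
  have hM1 : 1 ≤ M := hM ▸ Nat.one_le_two_pow
  have h1 : 2 ^ 1 ≤ 2 ^ M := Nat.pow_le_pow_right (by norm_num) hM1
  have hlt : 2 ^ M < 2 ^ (2 * M + 1) := Nat.pow_lt_pow_right (by norm_num) (by omega)
  refine le_antisymm (le_of_not_gt fun h => ?_) ?_
  · rw [← ENat.natCast_add_one_le_iff] at h
    have h2 := (natCast_le_ap_iff (s := M) (r := 2 * M + 1) (by omega)).1
      (by exact_mod_cast h : ((2 * M + 1 : ℕ) : ℕ∞) ≤ _)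
    rw [val_leftPow_of_le (by omega) (by omega),
      hL.tableOp_pred hM Nat.one_le_two_pow le_rfl, ← pow_add, ← two_mul] at h2
    exact absurd h2 (Nat.pow_lt_pow_right (by norm_num) (by omega)).ne
  · subst hM
    refine (hL.doubles_of_lt ?_).1
    rw [crit_leftPow_pred hM1]
    norm_cast

/-- Strict monotonicity leaves no other choice, as 0 goes to M and M to 2M. -/
theorem Ladder.ap_leftPow_pred_add {n M : ℕ} (hL : Ladder n) (hM : M = 2 ^ n) {i : ℕ}
    (hi : i ≤ M) : (leftPow (2 ^ M - 1)).ap i = (M + i : ℕ) := by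
  have hM1 : 1 ≤ M := hM ▸ Nat.one_le_two_pow
  obtain ⟨d, hd⟩ := Nat.exists_eq_add_of_le hi
  have h1 := ap_add_le (leftPow (2 ^ M - 1)) 0 i
  have h2 := ap_add_le (leftPow (2 ^ M - 1)) i d
  rw [ap_leftPow_pred_zero hM1, zero_add] at h1
  rw [← hd, hL.ap_leftPow_pred hM] at h2
  obtain ⟨c, hc⟩ := ENat.ne_top_iff_exists.1
    (ne_top_of_le_ne_top (ENat.natCast_ne_top _) (le_self_add.trans h2))
  rw [← hc] at h1 h2 ⊢
  norm_cast at h1 h2 ⊢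
  omega

theorem Ladder.succ {n : ℕ} (hL : Ladder n) : Ladder (n + 1) := by
  intro m hm
  have hM1 : 1 ≤ 2 ^ n := Nat.one_le_two_pow
  have hpow : 2 ^ (n + 1) = 2 * 2 ^ n := by ring
  rcases Nat.lt_succ_iff_lt_or_eq.1 hm with h | rfl
  · obtain ⟨κ, h1, h2, h3⟩ := hL m h
    have hp : 2 ^ (m + 1) ≤ 2 ^ n := Nat.pow_le_pow_right (by norm_num) h
    have hp' : 2 ^ (m + 1) = 2 ^ m + 2 ^ m := by ring
    have hp0 : 0 < 2 ^ m := by positivity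
    have e1 := hL.ap_leftPow_pred_add rfl (i := 2 ^ n - 2 ^ (m + 1)) (by omega)
    have e2 := hL.ap_leftPow_pred_add rfl (i := 2 ^ n - 2 ^ m) (by omega)
    have e3 := hL.ap_leftPow_pred_add rfl (i := 2 ^ n) le_rfl
    rw [show 2 ^ n + (2 ^ n - 2 ^ (m + 1)) = 2 ^ (n + 1) - 2 ^ (m + 1) by omega] at e1
    rw [show 2 ^ n + (2 ^ n - 2 ^ m) = 2 ^ (n + 1) - 2 ^ m by omega] at e2
    rw [show 2 ^ n + 2 ^ n = 2 ^ (n + 1) by omega] at e3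
    refine ⟨.app (leftPow (2 ^ 2 ^ n - 1)) κ, ?_, ?_, ?_⟩
    · rw [crit_app, h1, e1]
    · rw [← e1, ← ap_ap, h2, e2]
    · rw [← e2, ← ap_ap, h3, e3]
  · refine ⟨leftPow (2 ^ 2 ^ m - 1), ?_, ?_, ?_⟩
    · rw [Nat.sub_self, crit_leftPow_pred hM1]
    · rw [Nat.sub_self, ap_leftPow_pred_zero hM1]
      norm_cast; omega
    · rw [show 2 ^ (m + 1) - 2 ^ m = 2 ^ m by omega, hL.ap_leftPow_pred rfl, hpow]

theorem ladder (n : ℕ) : Ladder n := by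
  induction n with
  | zero => intro m hm; omega
  | succ n ih => exact ih.succ

/-! ### The three statements in the formal notation -/

theorem finSeq_iff {k : Word} {a b c : ℕ} :
    FinSeq k a b c ↔ k.crit = a ∧ k.ap a = b ∧ k.ap b = c := by
  simp only [FinSeq, FinCritEq, FinApplyEq, FinApplyGE, ap_natCast, ← isGreatest_crit_iff]

theorem exists_finSeq {n m : ℕ} (hm : m < n) :
    ∃ κ : Word, FinSeq κ (2 ^ n - 2 ^ (m + 1)) (2 ^ n - 2 ^ m) (2 ^ n) := by
  obtain ⟨κ, h⟩ := ladder n m hm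
  exact ⟨κ, finSeq_iff.2 h⟩

theorem finApplyGE_two_pow {n : ℕ} {k : Word} (hk : k.residue (2 ^ n) ≠ 0) :
    FinApplyGE k (2 ^ n) (2 ^ (n + 1)) ∧
      (2 ^ 2 ^ n < k.residue (2 ^ (n + 1)) → FinApplyGE k (2 ^ n) (2 ^ (n + 1) + 1)) := by
  have hpow : 2 ^ (n + 1) = 2 * 2 ^ n := by ring
  have hc : k.crit < (2 ^ n : ℕ) := by rw [← not_le, natCast_le_crit]; exact hk
  obtain ⟨h1, h2⟩ := (ladder n).doubles_of_lt hc
  rw [hpow, ← natCast_le_ap, ← natCast_le_ap]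
  refine ⟨h1, fun hr => ?_⟩
  by_contra hlt
  have h3 : k.ap (2 ^ n : ℕ) ≤ (2 * 2 ^ n : ℕ) := by
    refine le_of_not_gt fun h => hlt ?_
    rw [← ENat.natCast_add_one_le_iff] at h
    exact_mod_cast h
  exact absurd ((Nat.mod_le _ _).trans_lt (h2 h3)) hr.not_gt

theorem finSeq_leftPow (n : ℕ) :
    FinSeq (Word.leftPow (2 ^ 2 ^ n - 1)) 0 (2 ^ n) (2 ^ (n + 1)) := by
  rw [finSeq_iff]
  refine ⟨crit_leftPow_pred Nat.one_le_two_pow, ap_leftPow_pred_zero Nat.one_le_two_pow, ?_⟩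
  rw [(ladder n).ap_leftPow_pred rfl, pow_succ']

end EmbAlg

namespace EmbAlg

open FirstOrder FirstOrder.Language ZFSet

variable {lam : Ordinal.{u}}

/-! ### Elementary embeddings and ordinals -/

theorem isOrdinal_iff_VSet (x : VSet lam) : x.1.IsOrdinal ↔
    (∀ y : VSet lam, y.1 ∈ x.1 → ∀ z : VSet lam, z.1 ∈ y.1 → z.1 ∈ x.1) ∧
    ∀ y : VSet lam, y.1 ∈ x.1 → ∀ z : VSet lam, z.1 ∈ y.1 → ∀ t : VSet lam, t.1 ∈ z.1 →
      t.1 ∈ y.1 := by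
  rw [isOrdinal_iff_forall_mem_isTransitive]
  constructor
  · rintro ⟨h1, h2⟩
    exact ⟨fun y hy z hz => h1 _ hy hz, fun y hy z hz t ht => h2 _ hy _ hz ht⟩
  · rintro ⟨h1, h2⟩
    refine ⟨fun y hy z hz => ?_, fun y hy z hz t ht => ?_⟩
    · have hy' := mem_V_of_mem hy x.2
      exact h1 ⟨y, hy'⟩ hy ⟨z, mem_V_of_mem hz hy'⟩ hz
    · have hy' := mem_V_of_mem hy x.2
      have hz' := mem_V_of_mem hz hy'
      exact h2 ⟨y, hy'⟩ hy ⟨z, hz'⟩ hz ⟨t, mem_V_of_mem ht hz'⟩ ht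

theorem isOrdinal_emb (k : Emb lam) {x : VSet lam} (hx : x.1.IsOrdinal) : (k x).1.IsOrdinal := by
  have key : Dfn (fun v : Unit → VSet lam =>
      (∀ y : VSet lam, y.1 ∈ (v ()).1 → ∀ z : VSet lam, z.1 ∈ y.1 → z.1 ∈ (v ()).1) ∧
      ∀ y : VSet lam, y.1 ∈ (v ()).1 → ∀ z : VSet lam, z.1 ∈ y.1 → ∀ t : VSet lam, t.1 ∈ z.1 →
        t.1 ∈ y.1) :=
    Dfn.and
      (Dfn.all₁ (Dfn.imp (Dfn.mem _ _) (Dfn.all₁ (Dfn.imp (Dfn.mem _ _) (Dfn.mem _ _)))))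
      (Dfn.all₁ (Dfn.imp (Dfn.mem _ _) (Dfn.all₁ (Dfn.imp (Dfn.mem _ _)
        (Dfn.all₁ (Dfn.imp (Dfn.mem _ _) (Dfn.mem _ _)))))))
  rw [isOrdinal_iff_VSet]
  exact (key.map k fun _ => x).2 ((isOrdinal_iff_VSet x).1 hx)

theorem ordSet_mem_ordSet {α β : Ordinal.{u}} (hα : α < lam) (hβ : β < lam) :
    (ordSet α hα).1 ∈ (ordSet β hβ).1 ↔ α < β :=
  Ordinal.toZFSet_mem_toZFSet_iff

theorem ordSet_inj {α β : Ordinal.{u}} {hα : α < lam} {hβ : β < lam} :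
    ordSet α hα = ordSet β hβ ↔ α = β := by
  refine ⟨fun h => Ordinal.toZFSet_injective (congrArg Subtype.val h), ?_⟩
  rintro rfl; rfl

theorem exists_eq_ordSet {x : VSet lam} {α : Ordinal.{u}} {hα : α < lam}
    (h : x.1 ∈ (ordSet α hα).1) : ∃ (β : Ordinal.{u}) (h : β < α), x = ordSet β (h.trans hα) := by
  obtain ⟨β, hβ, e⟩ := Ordinal.mem_toZFSet_iff.1 h
  exact ⟨β, hβ, Subtype.ext e.symm⟩

theorem exists_mapsOrd (k : Emb lam) {α : Ordinal.{u}} (hα : α < lam) : ∃ β, MapsOrd k α β := by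
  have h := isOrdinal_emb k (x := ordSet α hα) (isOrdinal_toZFSet α)
  exact ⟨_, hα, mem_vonNeumann.1 (k (ordSet α hα)).2, Subtype.ext h.toZFSet_rank_eq.symm⟩

theorem MapsOrd.lt_iff {k : Emb lam} {α β α' β' : Ordinal.{u}} (h : MapsOrd k α β)
    (h' : MapsOrd k α' β') : β < β' ↔ α < α' := by
  obtain ⟨hα, hβ, e⟩ := h
  obtain ⟨hα', hβ', e'⟩ := h'
  rw [← ordSet_mem_ordSet hβ hβ', ← e, ← e', emb_mem, ordSet_mem_ordSet]

theorem MapsOrd.unique {k : Emb lam} {α β β' : Ordinal.{u}} (h : MapsOrd k α β)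
    (h' : MapsOrd k α β') : β = β' :=
  le_antisymm (le_of_not_gt fun hlt => lt_irrefl _ ((h'.lt_iff h).1 hlt))
    (le_of_not_gt fun hlt => lt_irrefl _ ((h.lt_iff h').1 hlt))

theorem MapsOrd.le {k : Emb lam} {α β : Ordinal.{u}} (h : MapsOrd k α β) : α ≤ β := by
  induction α using WellFoundedLT.induction generalizing β with
  | _ α ih =>
    by_contra hlt
    rw [not_le] at hlt
    obtain ⟨β', h'⟩ := exists_mapsOrd k (hlt.trans h.1)
    exact absurd (ih β hlt h') (not_le.2 ((h'.lt_iff h).2 hlt))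

theorem mapsOrd_self_iff (k : Emb lam) {α : Ordinal.{u}} (hα : α < lam) :
    MapsOrd k α α ↔ (ordSet α hα).1 ∉ (k (ordSet α hα)).1 := by
  obtain ⟨β, hα', hβ, e⟩ := exists_mapsOrd k hα
  rw [e, ordSet_mem_ordSet]
  constructor
  · intro h
    rw [h.unique ⟨hα', hβ, e⟩]
    exact lt_irrefl _
  · intro h
    obtain rfl := le_antisymm (MapsOrd.le ⟨hα', hβ, e⟩) (not_lt.1 h)
    exact ⟨hα', hβ, e⟩

/-- `x` has a rank function into the ordinal `o`, in the sense of `V_λ`. -/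
def RankBelow (x o : VSet lam) : Prop :=
  ∃ t : VSet lam, ∃ r : VSet lam, x.1 ∈ t.1 ∧
    (∀ y : VSet lam, y.1 ∈ t.1 → ∀ z : VSet lam, z.1 ∈ y.1 → z.1 ∈ t.1) ∧
    ∀ y : VSet lam, y.1 ∈ t.1 → ∃ p : VSet lam, p.1 ∈ o.1 ∧ pair y.1 p.1 ∈ r.1 ∧
      ∀ z : VSet lam, z.1 ∈ y.1 → ∀ q : VSet lam, pair z.1 q.1 ∈ r.1 → q.1 ∈ p.1

/-- The relation `r` need not be a function: induction on rank shows that each member of `t` is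
related to some ordinal of at least its own rank. Conversely the true rank function on V_α is a set
in V_λ because λ is a limit. -/
theorem rankBelow_iff (hlam : Order.IsSuccLimit lam) (x : VSet lam) {α : Ordinal.{u}}
    (hα : α < lam) : RankBelow x (ordSet α hα) ↔ x.1 ∈ V_ α := by
  constructor
  · rintro ⟨t, r, hx, ht, H⟩
    have key : ∀ (ρ : Ordinal.{u}) (y : VSet lam), rank y.1 = ρ → y.1 ∈ t.1 →
        ∃ p : VSet lam, p.1 ∈ (ordSet α hα).1 ∧ pair y.1 p.1 ∈ r.1 ∧ rank y.1 ≤ rank p.1 := by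
      intro ρ
      induction ρ using WellFoundedLT.induction with
      | _ ρ ih =>
        rintro y rfl hy
        obtain ⟨p, hp, hyp, hz⟩ := H y hy
        refine ⟨p, hp, hyp, rank_le_iff.2 fun {z} hzy => ?_⟩
        have hzV := mem_V_of_mem hzy y.2
        obtain ⟨q, -, hzq, hle⟩ := ih _ (rank_lt_of_mem hzy) ⟨z, hzV⟩ rfl (ht y hy ⟨z, hzV⟩ hzy)
        exact hle.trans_lt (rank_lt_of_mem (hz ⟨z, hzV⟩ hzy q hzq))
    obtain ⟨p, hp, -, hle⟩ := key _ x rfl hx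
    rw [mem_vonNeumann]
    refine hle.trans_lt ?_
    have := rank_lt_of_mem hp
    rwa [show rank (ordSet α hα).1 = α from Ordinal.rank_toZFSet α] at this
  · intro hx
    have hr := graph_mem_V hlam (fun y p => p = (rank y).toZFSet) (lev α hα) (ordSet α hα)
    refine ⟨lev α hα, ⟨_, hr⟩, hx, fun y hy z hz => mem_V_of_mem hz hy, fun y hy => ?_⟩
    have hy' := mem_vonNeumann.1 hy
    refine ⟨ordSet (rank y.1) (hy'.trans hα), (ordSet_mem_ordSet _ _).2 hy', ?_, ?_⟩
    · exact mem_pairSep.2 ⟨_, hy, _, (ordSet_mem_ordSet _ hα).2 hy', rfl, rfl⟩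
    · intro z hz q hq
      obtain ⟨s, -, t, -, e, rfl⟩ := mem_pairSep.1 hq
      obtain ⟨h1, h2⟩ := pair_inj.1 e
      rw [h2, ← h1]
      exact Ordinal.toZFSet_mem_toZFSet_iff.2 (rank_lt_of_mem hz)

/-- V_α is definable from α inside V_λ by way of rank functions, so elementarity applies. -/
theorem emb_lev (hlam : Order.IsSuccLimit lam) {k : Emb lam} {α β : Ordinal.{u}}
    (h : MapsOrd k α β) : k (lev α h.1) = lev β h.2.1 := by
  obtain ⟨hα, hβ, e⟩ := h
  have key : Dfn (fun v : Fin 2 → VSet lam => ∀ x : VSet lam, x.1 ∈ (v 0).1 ↔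
      ∃ t : VSet lam, ∃ r : VSet lam, x.1 ∈ t.1 ∧
        (∀ y : VSet lam, y.1 ∈ t.1 → ∀ z : VSet lam, z.1 ∈ y.1 → z.1 ∈ t.1) ∧
        ∀ y : VSet lam, y.1 ∈ t.1 → ∃ p : VSet lam, p.1 ∈ (v 1).1 ∧ pair y.1 p.1 ∈ r.1 ∧
          ∀ z : VSet lam, z.1 ∈ y.1 → ∀ q : VSet lam, pair z.1 q.1 ∈ r.1 → q.1 ∈ p.1) :=
    Dfn.all₁ (Dfn.iff (Dfn.mem _ _) (Dfn.ex₁ (Dfn.ex₁ (Dfn.and (Dfn.mem _ _) (Dfn.and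
      (Dfn.all₁ (Dfn.imp (Dfn.mem _ _) (Dfn.all₁ (Dfn.imp (Dfn.mem _ _) (Dfn.mem _ _)))))
      (Dfn.all₁ (Dfn.imp (Dfn.mem _ _) (Dfn.ex₁ (Dfn.and (Dfn.mem _ _)
        (Dfn.and (Dfn.pairMem hlam _ _ _) (Dfn.all₁ (Dfn.imp (Dfn.mem _ _)
          (Dfn.all₁ (Dfn.imp (Dfn.pairMem hlam _ _ _) (Dfn.mem _ _)))))))))))))))
  have h1 : ∀ x : VSet lam, x.1 ∈ (k (lev α hα)).1 ↔ RankBelow x (k (ordSet α hα)) :=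
    (key.map k ![lev α hα, ordSet α hα]).2 fun x => (rankBelow_iff hlam x hα).symm
  refine Subtype.ext ((ext_V (k (lev α hα)).2 (lev β hβ).2).2 fun x => ?_)
  rw [h1, e, rankBelow_iff hlam]
  rfl

/-- Induction on rank: k(x) ⊆ k(V_ρ) = V_ρ for ρ = rank x, so all members of k(x), like those of
`x`, are already known to be fixed. -/
theorem emb_eq_self (hlam : Order.IsSuccLimit lam) {k : Emb lam} {κ : Ordinal.{u}}
    (h : ∀ β < κ, MapsOrd k β β) (x : VSet lam) (hx : x.1 ∈ V_ κ) : k x = x := by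
  have key : ∀ (ρ : Ordinal.{u}) (x : VSet lam), rank x.1 = ρ → ρ < κ → k x = x := by
    intro ρ
    induction ρ using WellFoundedLT.induction with
    | _ ρ ih =>
      rintro x rfl hx
      have hl := emb_lev hlam (h _ hx)
      refine Subtype.ext ((ext_V (k x).2 x.2).2 fun z => ⟨fun hz => ?_, fun hz => ?_⟩)
      · have h1 := emb_subset k (x := x) (y := lev _ (h _ hx).1) (subset_vonNeumann_self x.1)
        rw [hl] at h1
        have h2 := mem_vonNeumann.1 (h1 hz)
        rwa [← ih _ h2 z rfl (h2.trans hx), emb_mem] at hz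
      · have h2 := rank_lt_of_mem hz
        rwa [← emb_mem k, ih _ h2 z rfl (h2.trans hx)] at hz
  exact key _ x rfl (mem_vonNeumann.1 hx)

/-! ### Critical points -/

theorem Nontriv.exists_isCrit (hlam : Order.IsSuccLimit lam) {k : Emb lam} (h : Nontriv k) :
    ∃ κ, IsCrit k κ := by
  obtain ⟨x, hx⟩ := h
  have hne : {α | α < lam ∧ ¬ MapsOrd k α α}.Nonempty := by
    by_contra hemp
    rw [Set.not_nonempty_iff_eq_empty] at hemp
    refine hx (emb_eq_self hlam (κ := lam) (fun β hβ => ?_) x x.2)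
    by_contra hc
    exact (hemp ▸ (⟨hβ, hc⟩ : β ∈ {α | α < lam ∧ ¬ MapsOrd k α α}) : β ∈ (∅ : Set _))
  obtain ⟨h1, h2⟩ := csInf_mem hne
  refine ⟨_, h1, h2, fun β hβ => ?_⟩
  by_contra hc
  exact notMem_of_lt_csInf' hβ ⟨hβ.trans h1, hc⟩

theorem IsCrit.unique {k : Emb lam} {α β : Ordinal.{u}} (h : IsCrit k α) (h' : IsCrit k β) :
    α = β :=
  le_antisymm (le_of_not_gt fun hlt => h'.2.1 (h.2.2 _ hlt))
    (le_of_not_gt fun hlt => h.2.1 (h'.2.2 _ hlt))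

theorem IsCrit.lt_of_mapsOrd {k : Emb lam} {α β : Ordinal.{u}} (h : IsCrit k α)
    (h' : MapsOrd k α β) : α < β :=
  lt_of_le_of_ne h'.le fun e => h.2.1 (by rwa [← e] at h')

theorem IsCrit.isSuccLimit {k : Emb lam} {κ : Ordinal.{u}} (h : IsCrit k κ) :
    Order.IsSuccLimit κ := by
  obtain ⟨β, hβ⟩ := exists_mapsOrd k h.1
  have hlt := h.lt_of_mapsOrd hβ
  obtain ⟨hκ, hβl, e⟩ := hβ
  have hmem : (ordSet κ hκ).1 ∈ (k (ordSet κ hκ)).1 := by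
    rw [e]; exact (ordSet_mem_ordSet _ _).2 hlt
  rcases Ordinal.zero_or_succ_or_isSuccLimit κ with rfl | ⟨α, rfl⟩ | hlim
  · have key : Dfn (fun v : Unit → VSet lam => ∀ x : VSet lam, ¬ x.1 ∈ (v ()).1) :=
      Dfn.all₁ (Dfn.not (Dfn.mem _ _))
    exact absurd hmem ((key.map k fun _ => ordSet 0 hκ).2 (fun x => by simp [ordSet]) _)
  · have hα : α < lam := (Order.lt_succ α).trans hκ
    have key : Dfn (fun v : Fin 2 → VSet lam =>
        ∀ x : VSet lam, x.1 ∈ (v 1).1 → x.1 ∈ (v 0).1 ∨ x = v 0) :=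
      Dfn.all₁ (Dfn.imp (Dfn.mem _ _) (Dfn.or (Dfn.mem _ _) (Dfn.eq _ _)))
    have h1 := (key.map k ![ordSet α hα, ordSet _ hκ]).2 (by
      intro x hx
      obtain ⟨β, hβ, rfl⟩ := exists_eq_ordSet (hα := hκ) hx
      rcases (Order.lt_succ_iff.1 hβ).lt_or_eq with h' | rfl
      · exact Or.inl ((ordSet_mem_ordSet _ hα).2 h')
      · exact Or.inr rfl)
    have h2 := h1 _ hmem
    obtain ⟨_, _, e'⟩ := h.2.2 α (Order.lt_succ α)
    simp only [Function.comp_apply, Matrix.cons_val_zero, e', ordSet_mem_ordSet, ordSet_inj] at h2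
    rcases h2 with h2 | h2
    · exact absurd h2 (Order.lt_succ α).not_gt
    · exact absurd h2 (Order.lt_succ α).ne'
  · exact hlim

/-! ### Application -/

theorem appRel_iff (hlam : Order.IsSuccLimit lam) (a b : Emb lam) (x y : VSet lam) :
    AppRel hlam a b x y ↔ app hlam a b x = y := by
  have h := (appRel_existsUnique hlam a b x).choose_spec
  constructor
  · intro hy
    exact (h.2 y hy).symm
  · rintro rfl
    exact h.1

theorem pair_mem_emb_restr (hlam : Order.IsSuccLimit lam) (a b : Emb lam) {α : Ordinal.{u}}
    (hα : α < lam) (x y : VSet lam) :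
    pair x.1 y.1 ∈ (a (restr hlam b α hα)).1 ↔
      x.1 ∈ (a (lev α hα)).1 ∧ app hlam a b x = y := by
  have key1 : Dfn (fun v : Fin 2 → VSet lam => ∀ x : VSet lam, ∀ y : VSet lam,
      pair x.1 y.1 ∈ (v 0).1 → x.1 ∈ (v 1).1) :=
    Dfn.all₁ (Dfn.all₁ (Dfn.imp (Dfn.pairMem hlam _ _ _) (Dfn.mem _ _)))
  have key2 : Dfn (fun v : Fin 2 → VSet lam => ∀ x : VSet lam, x.1 ∈ (v 1).1 →
      ∃ y : VSet lam, pair x.1 y.1 ∈ (v 0).1) :=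
    Dfn.all₁ (Dfn.imp (Dfn.mem _ _) (Dfn.ex₁ (Dfn.pairMem hlam _ _ _)))
  have h1 := (key1.map a ![restr hlam b α hα, lev α hα]).2 fun x y h =>
    ((pair_mem_restr hlam b α hα x y).1 h).1
  have h2 := (key2.map a ![restr hlam b α hα, lev α hα]).2 fun x h =>
    ⟨b x, (pair_mem_restr hlam b α hα x _).2 ⟨h, rfl⟩⟩
  constructor
  · intro h
    exact ⟨h1 x y h, (appRel_iff hlam a b x y).1 ⟨α, hα, h⟩⟩
  · rintro ⟨hx, rfl⟩
    obtain ⟨y, hy⟩ := h2 x hx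
    rwa [(appRel_iff hlam a b x y).1 ⟨α, hα, hy⟩]

theorem app_apply (hlam : Order.IsSuccLimit lam) (a b : Emb lam) (x : VSet lam) :
    app hlam a b (a x) = a (b x) := by
  have hr := hlam.succ_lt (mem_vonNeumann.1 x.2)
  have h := ((Dfn.pairMem hlam (0 : Fin 3) 1 2).map a ![x, b x, restr hlam b _ hr]).2
    ((pair_mem_restr hlam b _ hr x _).2 ⟨mem_vonNeumann_succ x.1, rfl⟩)
  exact ((pair_mem_emb_restr hlam a b hr _ _).1 h).2

/-- Apply `a` to the inclusion of (bc) ↾ V_α in b(c ↾ V_α), and `app a b` to that of a(c ↾ V_α) in a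
restriction of ac; by `app_apply`, a(b(c ↾ V_α)) = (ab)(a(c ↾ V_α)) joins the two. -/
theorem app_distrib (hlam : Order.IsSuccLimit lam) (a b c : Emb lam) :
    app hlam a (app hlam b c) = app hlam (app hlam a b) (app hlam a c) := by
  refine DFunLike.ext _ _ fun z => ?_
  have hα := hlam.succ_lt (mem_vonNeumann.1 z.2)
  set α := Order.succ (rank z.1)
  have hβ := mem_vonNeumann.1 (a (lev α hα)).2
  set β := rank (a (lev α hα)).1
  have key : Dfn (fun v : Fin 2 → VSet lam => ∀ x : VSet lam, ∀ y : VSet lam,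
      pair x.1 y.1 ∈ (v 0).1 → pair x.1 y.1 ∈ (v 1).1) :=
    Dfn.all₁ (Dfn.all₁ (Dfn.imp (Dfn.pairMem hlam _ _ _) (Dfn.pairMem hlam _ _ _)))
  have h1 := (key.map a ![restr hlam (app hlam b c) α hα, b (restr hlam c α hα)]).2 (by
    intro x y h
    obtain ⟨hx, e⟩ := (pair_mem_restr hlam _ α hα x y).1 h
    exact (pair_mem_emb_restr hlam b c hα x y).2 ⟨subset_emb_lev hlam b α hα hx, e⟩)
  have h2 := (key.map (app hlam a b) ![a (restr hlam c α hα), restr hlam (app hlam a c) β hβ]).2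
    (by
      intro x y h
      obtain ⟨hx, e⟩ := (pair_mem_emb_restr hlam a c hα x y).1 h
      exact (pair_mem_restr hlam _ β hβ x y).2 ⟨subset_vonNeumann_self _ hx, e⟩)
  have h3 := h1 z (app hlam a (app hlam b c) z) ((pair_mem_emb_restr hlam a _ hα z _).2
    ⟨subset_emb_lev hlam a α hα (mem_vonNeumann_succ z.1), rfl⟩)
  have h4 : pair z.1 (app hlam a (app hlam b c) z).1 ∈
      (app hlam a b (a (restr hlam c α hα))).1 := by
    rw [app_apply]; exact h3
  exact ((appRel_iff hlam _ _ _ _).1 ⟨β, hβ, h2 _ _ h4⟩).symm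

theorem IsCrit.app (hlam : Order.IsSuccLimit lam) {a b : Emb lam} {κ κ' : Ordinal.{u}}
    (hb : IsCrit b κ) (ha : MapsOrd a κ κ') : IsCrit (app hlam a b) κ' := by
  obtain ⟨hκ, hκ', e⟩ := ha
  have hδ := hlam.succ_lt hκ
  have key : Dfn (fun v : Fin 2 → VSet lam => ∀ x : VSet lam, x.1 ∈ (v 0).1 →
      pair x.1 x.1 ∈ (v 1).1) :=
    Dfn.all₁ (Dfn.imp (Dfn.mem _ _) (Dfn.pairMem hlam _ _ _))
  have h1 := (key.map a ![ordSet κ hκ, restr hlam b _ hδ]).2 (by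
    intro x hx
    obtain ⟨β, hβ, rfl⟩ := exists_eq_ordSet (hα := hκ) hx
    obtain ⟨_, _, e'⟩ := hb.2.2 β hβ
    refine (pair_mem_restr hlam b _ hδ _ _).2 ⟨?_, e'⟩
    rw [mem_vonNeumann, ordSet, Ordinal.rank_toZFSet]
    exact hβ.trans (Order.lt_succ κ))
  refine ⟨hκ', fun ⟨_, _, h⟩ => ?_, fun β hβ => ?_⟩
  · rw [← e, app_apply] at h
    exact hb.2.1 ⟨hκ, hκ, a.injective h⟩
  · refine ⟨hβ.trans hκ', hβ.trans hκ', ?_⟩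
    refine ((pair_mem_emb_restr hlam a b hδ _ _).1 (h1 (ordSet β (hβ.trans hκ')) ?_)).2
    change _ ∈ (a (ordSet κ hκ)).1
    rw [e]
    exact (ordSet_mem_ordSet _ _).2 hβ

/-! ### Equivalence up to a level -/

/-- The embeddings agree up to `γ`: `k x ∩ V_γ = l x ∩ V_γ` for all `x ∈ V_γ`. -/
def EqvUpTo (γ : Ordinal.{u}) (k l : Emb lam) : Prop :=
  ∀ x y : VSet lam, x.1 ∈ V_ γ → y.1 ∈ V_ γ → (y.1 ∈ (k x).1 ↔ y.1 ∈ (l x).1)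

namespace EqvUpTo

variable {γ : Ordinal.{u}} {f g k l : Emb lam}

theorem refl (γ : Ordinal.{u}) (k : Emb lam) : EqvUpTo γ k k := fun _ _ _ _ => Iff.rfl

theorem symm (h : EqvUpTo γ k l) : EqvUpTo γ l k := fun x y hx hy => (h x y hx hy).symm

theorem trans (h : EqvUpTo γ k l) (h' : EqvUpTo γ l f) : EqvUpTo γ k f :=
  fun x y hx hy => (h x y hx hy).trans (h' x y hx hy)

theorem mono {δ : Ordinal.{u}} (h : EqvUpTo γ k l) (hδ : δ ≤ γ) : EqvUpTo δ k l :=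
  fun x y hx hy => h x y (vonNeumann_subset_of_le hδ hx) (vonNeumann_subset_of_le hδ hy)

theorem mapsOrd_self (h : EqvUpTo γ k l) {α : Ordinal.{u}} (hα : α < γ) (hk : MapsOrd k α α) :
    MapsOrd l α α := by
  have hαl := hk.1
  rw [mapsOrd_self_iff _ hαl] at hk ⊢
  have hm : (ordSet α hαl).1 ∈ V_ γ := by
    rwa [mem_vonNeumann, ordSet, Ordinal.rank_toZFSet]
  rwa [← h _ _ hm hm]

theorem isCrit (h : EqvUpTo γ k l) {κ : Ordinal.{u}} (hκ : κ < γ) (hk : IsCrit k κ) :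
    IsCrit l κ :=
  ⟨hk.1, fun hl => hk.2.1 (h.symm.mapsOrd_self hκ hl),
    fun β hβ => h.mapsOrd_self (hβ.trans hκ) (hk.2.2 β hβ)⟩

theorem app_left (hlam : Order.IsSuccLimit lam) (hγ : Order.IsSuccLimit γ)
    (h : EqvUpTo γ k l) (g : Emb lam) : EqvUpTo γ (app hlam k g) (app hlam l g) := by
  intro x y hx hy
  have hrx := mem_vonNeumann.1 hx
  have hry := mem_vonNeumann.1 hy
  have hβγ := hγ.succ_lt (max_lt hrx hry)
  have hβ := hlam.succ_lt (max_lt (mem_vonNeumann.1 x.2) (mem_vonNeumann.1 y.2))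
  set β := Order.succ (max (rank x.1) (rank y.1))
  have hxβ : x.1 ∈ V_ β := mem_vonNeumann.2 (Order.lt_succ_iff.2 (le_max_left _ _))
  have hyβ : y.1 ∈ V_ β := mem_vonNeumann.2 (Order.lt_succ_iff.2 (le_max_right _ _))
  let p : ZFSet.{u} → ZFSet.{u} → Prop := fun u v => ∃ h : u ∈ V_ lam, v ∈ (g ⟨u, h⟩).1
  -- The truncation of `g` coded as a set of pairs below γ: y ∈ f(g)(x) becomes (x, y) ∈ f(G), a
  -- question on which embeddings equivalent up to γ agree.
  let G : VSet lam := ⟨pairSep p (V_ β) (V_ β), graph_mem_V hlam p (lev β hβ) (lev β hβ)⟩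
  have hG : G.1 ∈ V_ γ := graph_mem_V hγ p (lev β hβγ) (lev β hβγ)
  have hmem : ∀ u v : VSet lam, u.1 ∈ V_ β → v.1 ∈ V_ β → (pair u.1 v.1 ∈ G.1 ↔ v.1 ∈ (g u).1) := by
    intro u v hu hv
    simp only [G, p, mem_pairSep, pair_inj]
    constructor
    · rintro ⟨s, hs, t, ht, ⟨e1, e2⟩, h1, h2⟩
      subst e1 e2
      exact h2
    · intro h'
      exact ⟨_, hu, _, hv, ⟨rfl, rfl⟩, u.2, h'⟩
  have key : Dfn (fun v : Fin 3 → VSet lam => ∀ s : VSet lam, ∀ w : VSet lam, ∀ t : VSet lam,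
      s.1 ∈ (v 0).1 → t.1 ∈ (v 0).1 → pair s.1 w.1 ∈ (v 1).1 →
        (t.1 ∈ w.1 ↔ pair s.1 t.1 ∈ (v 2).1)) :=
    Dfn.all₁ (Dfn.all₁ (Dfn.all₁ (Dfn.imp (Dfn.mem _ _) (Dfn.imp (Dfn.mem _ _)
      (Dfn.imp (Dfn.pairMem hlam _ _ _) (Dfn.iff (Dfn.mem _ _) (Dfn.pairMem hlam _ _ _)))))))
  have main : ∀ f : Emb lam, y.1 ∈ (app hlam f g x).1 ↔ pair x.1 y.1 ∈ (f G).1 := by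
    intro f
    have hx' := subset_emb_lev hlam f β hβ hxβ
    have hy' := subset_emb_lev hlam f β hβ hyβ
    refine (key.map f ![lev β hβ, restr hlam g β hβ, G]).2 ?_ x _ y hx' hy'
      ((pair_mem_emb_restr hlam f g hβ _ _).2 ⟨hx', rfl⟩)
    intro s w t hs ht hw
    obtain ⟨-, rfl⟩ := (pair_mem_restr hlam g β hβ s w).1 hw
    exact (hmem s t hs ht).symm
  have hpair : pair x.1 y.1 ∈ V_ γ :=
    pair_mem_V hγ (singleton_mem_V hγ hx) (pair_mem_V hγ hx hy)
  have hpair' : pair x.1 y.1 ∈ V_ lam :=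
    pair_mem_V hlam (singleton_mem_V hlam x.2) (pair_mem_V hlam x.2 y.2)
  rw [main, main]
  exact h G ⟨_, hpair'⟩ hG hpair

theorem app_right (hlam : Order.IsSuccLimit lam) {γ' : Ordinal.{u}} (hf : MapsOrd f γ γ')
    (h : EqvUpTo γ k l) : EqvUpTo γ' (app hlam f k) (app hlam f l) := by
  intro x y hx hy
  have hγ := hf.1
  have key : Dfn (fun v : Fin 3 → VSet lam => ∀ s : VSet lam, ∀ t : VSet lam, ∀ w : VSet lam,
      ∀ w' : VSet lam, s.1 ∈ (v 0).1 → t.1 ∈ (v 0).1 → pair s.1 w.1 ∈ (v 1).1 →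
        pair s.1 w'.1 ∈ (v 2).1 → (t.1 ∈ w.1 ↔ t.1 ∈ w'.1)) :=
    Dfn.all₁ (Dfn.all₁ (Dfn.all₁ (Dfn.all₁ (Dfn.imp (Dfn.mem _ _) (Dfn.imp (Dfn.mem _ _)
      (Dfn.imp (Dfn.pairMem hlam _ _ _) (Dfn.imp (Dfn.pairMem hlam _ _ _)
        (Dfn.iff (Dfn.mem _ _) (Dfn.mem _ _)))))))))
  have hl := emb_lev hlam hf
  have hx' : x.1 ∈ (f (lev γ hγ)).1 := by rw [hl]; exact hx
  have hy' : y.1 ∈ (f (lev γ hγ)).1 := by rw [hl]; exact hy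
  refine (key.map f ![lev γ hγ, restr hlam k γ hγ, restr hlam l γ hγ]).2 ?_ x y _ _ hx' hy'
    ((pair_mem_emb_restr hlam f k hγ _ _).2 ⟨hx', rfl⟩)
    ((pair_mem_emb_restr hlam f l hγ _ _).2 ⟨hx', rfl⟩)
  intro s t w w' hs ht hw hw'
  obtain ⟨-, rfl⟩ := (pair_mem_restr hlam k γ hγ s w).1 hw
  obtain ⟨-, rfl⟩ := (pair_mem_restr hlam l γ hγ s w').1 hw'
  exact h s t hs ht

theorem app_right_self (hlam : Order.IsSuccLimit lam) (hγ : γ < lam) (f : Emb lam)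
    (h : EqvUpTo γ k l) : EqvUpTo γ (app hlam f k) (app hlam f l) := by
  obtain ⟨γ', h'⟩ := exists_mapsOrd f hγ
  exact (app_right hlam h' h).mono h'.le

/-- Up to γ the embedding `f` agrees with the identity, and applying the identity to `g` returns
`g`. -/
theorem app_of_fixed (hlam : Order.IsSuccLimit lam) (hγ : Order.IsSuccLimit γ)
    (hf : ∀ β < γ, MapsOrd f β β) (g : Emb lam) : EqvUpTo γ (app hlam f g) g := by
  let i : Emb lam := ElementaryEmbedding.refl setLang (VSet lam)
  have h1 : EqvUpTo γ f i := fun x y hx _ => by rw [emb_eq_self hlam hf x hx]; rfl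
  have h2 : EmbAlg.app hlam i g = g := by
    refine DFunLike.ext _ _ fun x => (appRel_iff hlam i g x _).1
      ⟨_, hlam.succ_lt (mem_vonNeumann.1 x.2), ?_⟩
    exact (pair_mem_restr hlam g _ _ x _).2 ⟨mem_vonNeumann_succ x.1, rfl⟩
  have := app_left hlam hγ h1 g
  rwa [h2] at this

end EqvUpTo

end EmbAlg

namespace EmbAlg

open FirstOrder FirstOrder.Language ZFSet

variable {lam : Ordinal.{u}}

/-! ### The algebra generated by one embedding -/

section Generated

variable (hlam : Order.IsSuccLimit lam) (j : Emb lam)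

theorem inAlg_iff {k : Emb lam} : InAlg hlam j k ↔ ∃ w : Word, w.toEmb hlam j = k := by
  constructor
  · intro h
    induction h with
    | gen => exact ⟨.gen, rfl⟩
    | app _ _ iha ihb =>
      obtain ⟨v, rfl⟩ := iha
      obtain ⟨w, rfl⟩ := ihb
      exact ⟨.app v w, rfl⟩
  · rintro ⟨w, rfl⟩
    induction w with
    | gen => exact .gen
    | app k l hk hl => exact .app hk hl

/-- The embedding `j_(m)`. -/
noncomputable def leftPowEmb (m : ℕ) : Emb lam := (Word.leftPow m).toEmb hlam j

theorem leftPowEmb_succ {m : ℕ} (hm : 1 ≤ m) :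
    leftPowEmb hlam j (m + 1) = app hlam (leftPowEmb hlam j m) j := by
  obtain ⟨m, rfl⟩ := Nat.exists_eq_add_of_le' hm
  rfl

variable {j}

theorem exists_isCrit_toEmb (hj : Nontriv j) (w : Word) : ∃ κ, IsCrit (w.toEmb hlam j) κ := by
  induction w with
  | gen => exact hj.exists_isCrit hlam
  | app k l _ hl =>
    obtain ⟨κ, hκ⟩ := hl
    obtain ⟨α, hα⟩ := exists_mapsOrd (k.toEmb hlam j) hκ.1
    exact ⟨α, hκ.app hlam hα⟩

/-- Multiplication in the table computes application up to any level below which `j_(2^n)`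
fixes all ordinals. -/
theorem eqvUpTo_leftPowEmb_app {γ : Ordinal.{u}} (hγ : Order.IsSuccLimit γ) {n : ℕ}
    (hfix : ∀ β < γ, MapsOrd (leftPowEmb hlam j (2 ^ n)) β β) :
    ∀ (d a : ℕ), a + d = 2 ^ n → 1 ≤ a → ∀ b, 1 ≤ b →
      EqvUpTo γ (app hlam (leftPowEmb hlam j a) (leftPowEmb hlam j b))
        (leftPowEmb hlam j (tableOp n a b)) := by
  intro d
  induction d using Nat.strong_induction_on with
  | _ d ih =>
    intro a had ha b hb
    rcases Nat.eq_zero_or_pos d with rfl | hd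
    · obtain rfl : a = 2 ^ n := by omega
      rw [tableOp_top]
      exact EqvUpTo.app_of_fixed hlam hγ hfix _
    have ha' : a < 2 ^ n := by omega
    induction b, hb using Nat.le_induction with
    | base =>
      rw [tableOp_one ha', leftPowEmb_succ hlam j ha]
      exact EqvUpTo.refl _ _
    | succ b hb ihb =>
      have h1 := tableOp_lt ha' hb
      have h2 := tableOp_le ha' hb
      rw [leftPowEmb_succ hlam j hb, app_distrib, ← leftPowEmb_succ hlam j ha,
        tableOp_succ ha' hb]
      exact (EqvUpTo.app_left hlam hγ ihb _).trans
        (ih (2 ^ n - tableOp n a b) (by omega) _ (by omega) (by omega) _ (by omega))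

theorem eqvUpTo_val {γ : Ordinal.{u}} (hγ : Order.IsSuccLimit γ) (hγl : γ < lam) {n : ℕ}
    (hfix : ∀ β < γ, MapsOrd (leftPowEmb hlam j (2 ^ n)) β β) (w : Word) :
    EqvUpTo γ (w.toEmb hlam j) (leftPowEmb hlam j (w.val n)) := by
  induction w with
  | gen => exact EqvUpTo.refl _ _
  | app k l hk hl =>
    have h1 := Word.val_le n k
    refine ((EqvUpTo.app_left hlam hγ hk _).trans (EqvUpTo.app_right_self hlam hγl _ hl)).trans ?_
    exact eqvUpTo_leftPowEmb_app hlam hγ hfix (2 ^ n - k.val n) _ (by omega)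
      (Word.one_le_val _ _) _ (Word.one_le_val _ _)

variable (j) in
/-- The critical point of `j_(2^n)`. -/
noncomputable def critPow (n : ℕ) : Ordinal.{u} :=
  sInf {α | IsCrit (leftPowEmb hlam j (2 ^ n)) α}

theorem isCrit_critPow (hj : Nontriv j) (n : ℕ) :
    IsCrit (leftPowEmb hlam j (2 ^ n)) (critPow hlam j n) :=
  csInf_mem (exists_isCrit_toEmb hlam hj (Word.leftPow (2 ^ n)))

theorem eqvUpTo_critPow (hj : Nontriv j) (n : ℕ) (w : Word) :
    EqvUpTo (critPow hlam j n) (w.toEmb hlam j) (leftPowEmb hlam j (w.val n)) :=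
  have h := isCrit_critPow hlam hj n
  eqvUpTo_val hlam h.isSuccLimit h.1 h.2.2 w

theorem exists_two_pow_dvd {m : ℕ} (hm : 1 ≤ m) : ∃ s, 2 ^ s ∣ m ∧ ¬ 2 ^ (s + 1) ∣ m := by
  have h : FiniteMultiplicity 2 m := Nat.finiteMultiplicity_iff.2 ⟨by norm_num, hm⟩
  exact ⟨multiplicity 2 m, pow_multiplicity_dvd 2 m, h.not_pow_dvd_of_multiplicity_lt (by omega)⟩

variable (j) in
/-- Up to `2^n`, the critical point of `j_(m)` depends only on the power of two dividing `m`. -/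
def CritPattern (n : ℕ) : Prop :=
  (∀ m s, m < 2 ^ n → 2 ^ s ∣ m → ¬ 2 ^ (s + 1) ∣ m →
    IsCrit (leftPowEmb hlam j m) (critPow hlam j s)) ∧
  ∀ s < n, critPow hlam j s < critPow hlam j (s + 1)

variable {hlam}

theorem CritPattern.lt {n : ℕ} (H : CritPattern hlam j n) {s t : ℕ} (hst : s < t) (ht : t ≤ n) :
    critPow hlam j s < critPow hlam j t := by
  induction t, hst using Nat.le_induction with
  | base => exact H.2 s ht
  | succ t hst ih => exact (ih (by omega)).trans (H.2 t ht)

theorem lt_of_two_pow_dvd {n m s : ℕ} (hm : m < 2 ^ n) (h : 2 ^ s ∣ m) (h' : ¬ 2 ^ (s + 1) ∣ m) :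
    s < n := by
  have h0 : 0 < m := Nat.pos_of_ne_zero fun e => h' (e ▸ dvd_zero _)
  exact (Nat.pow_lt_pow_iff_right (by norm_num : 1 < 2)).1 ((Nat.le_of_dvd h0 h).trans_lt hm)

theorem CritPattern.exists_eq {n : ℕ} (hj : Nontriv j) (H : CritPattern hlam j n) {w : Word}
    {κ : Ordinal.{u}} (hκ : IsCrit (w.toEmb hlam j) κ) (hlt : κ < critPow hlam j n) :
    ∃ s < n, κ = critPow hlam j s := by
  have h1 := (eqvUpTo_critPow hlam hj n w).isCrit hlt hκ
  rcases (Word.val_le n w).eq_or_lt with h | h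
  · rw [h] at h1
    exact absurd hlt (h1.unique (isCrit_critPow hlam hj n)).ge.not_gt
  · obtain ⟨s, hs, hnd⟩ := exists_two_pow_dvd (Word.one_le_val n w)
    exact ⟨s, lt_of_two_pow_dvd h hs hnd, h1.unique (H.1 _ s h hs hnd)⟩

/-- A member of the algebra whose critical point is below that of `j_(2^n)` moves the latter. -/
theorem CritPattern.lt_image {n : ℕ} (hj : Nontriv j) (H : CritPattern hlam j n) {w : Word}
    {κ β : Ordinal.{u}} (hκ : IsCrit (w.toEmb hlam j) κ) (hlt : κ < critPow hlam j n)
    (hβ : MapsOrd (w.toEmb hlam j) (critPow hlam j n) β) : critPow hlam j n < β := by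
  refine lt_of_le_of_ne hβ.le ?_
  rintro rfl
  -- If the point were fixed, the largest critical point α below it that `w` moves would have w(α)
  -- as a larger one; there are only finitely many, so this is absurd.
  let T : Set Ordinal.{u} := {α | α < critPow hlam j n ∧
    (∃ v : Word, IsCrit (v.toEmb hlam j) α) ∧ ∃ α', MapsOrd (w.toEmb hlam j) α α' ∧ α < α'}
  have hfin : T.Finite := by
    refine ((Set.finite_Iio n).image (critPow hlam j)).subset ?_
    rintro α ⟨h, ⟨v, hv⟩, -⟩
    obtain ⟨s, hs, rfl⟩ := H.exists_eq hj hv h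
    exact ⟨s, hs, rfl⟩
  obtain ⟨κ', hκ'⟩ := exists_mapsOrd (w.toEmb hlam j) hκ.1
  obtain ⟨α, ⟨hα, ⟨v, hv⟩, α', hα', hlt'⟩, hmax⟩ :=
    hfin.exists_maximalFor id T ⟨κ, hlt, ⟨w, hκ⟩, κ', hκ', hκ.lt_of_mapsOrd hκ'⟩
  obtain ⟨α'', hα''⟩ := exists_mapsOrd (w.toEmb hlam j) hα'.2.1
  refine absurd hlt' (not_lt.2 (hmax ⟨(hα'.lt_iff hβ).2 hα, ⟨.app w v, ?_⟩, α'', hα'',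
    (hα'.lt_iff hα'').2 hlt'⟩ hlt'.le))
  exact hv.app hlam hα'

theorem critPattern_zero : CritPattern hlam j 0 := by
  refine ⟨fun m s hm _ h => absurd ?_ h, fun s hs => absurd hs (Nat.not_lt_zero s)⟩
  obtain rfl : m = 0 := by simpa using hm
  exact dvd_zero _

theorem CritPattern.succ {n : ℕ} (hj : Nontriv j) (H : CritPattern hlam j n) :
    CritPattern hlam j (n + 1) := by
  set δ := critPow hlam j n with hδ
  set e := leftPowEmb hlam j (2 ^ n) with he
  have hcrit : IsCrit e δ := isCrit_critPow hlam hj n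
  have hpow : 2 ^ (n + 1) = 2 ^ n + 2 ^ n := by ring
  have hpos : 1 ≤ 2 ^ n := Nat.one_le_two_pow
  obtain ⟨ε, hε⟩ := exists_mapsOrd e hcrit.1
  have hee : IsCrit (app hlam e e) ε := hcrit.app hlam hε
  -- the next critical point above `δ`
  let S : Set Ordinal.{u} := {α | δ < α ∧ ∃ v : Word, IsCrit (v.toEmb hlam j) α}
  have hS : S.Nonempty :=
    ⟨ε, hcrit.lt_of_mapsOrd hε, .app (.leftPow (2 ^ n)) (.leftPow (2 ^ n)), hee⟩
  obtain ⟨hδ', v', hv'⟩ := csInf_mem hS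
  have hmin : ∀ α, δ < α → ∀ v : Word, IsCrit (v.toEmb hlam j) α → sInf S ≤ α :=
    fun α h v hv => csInf_le' ⟨h, v, hv⟩
  set δ' := sInf S
  have hlim := hv'.isSuccLimit
  -- Such a `w` moves δ, and w(δ) is again a critical point, hence at least the next one.
  have himage : ∀ (w : Word) (κ β : Ordinal.{u}), IsCrit (w.toEmb hlam j) κ → κ < δ →
      MapsOrd (w.toEmb hlam j) δ β → δ' ≤ β := fun w κ β hκ hlt hβ =>
    hmin β (H.lt_image hj hκ hlt hβ) (.app w (.leftPow (2 ^ n))) (hcrit.app hlam hβ)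
  have hej : EqvUpTo δ (app hlam e j) j :=
    EqvUpTo.app_of_fixed hlam hcrit.isSuccLimit hcrit.2.2 j
  have hlow : ∀ m, 1 ≤ m → EqvUpTo δ (leftPowEmb hlam j (2 ^ n + m)) (leftPowEmb hlam j m) := by
    intro m hm
    induction m, hm using Nat.le_induction with
    | base => rw [leftPowEmb_succ hlam j hpos]; exact hej
    | succ m hm ih =>
      rw [← add_assoc, leftPowEmb_succ hlam j (by omega), leftPowEmb_succ hlam j hm]
      exact EqvUpTo.app_left hlam hcrit.isSuccLimit ih j
  have hcritlow : ∀ m s, m < 2 ^ n → 2 ^ s ∣ m → ¬ 2 ^ (s + 1) ∣ m →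
      IsCrit (leftPowEmb hlam j (2 ^ n + m)) (critPow hlam j s) := by
    intro m s hm hs hs'
    have h0 : 1 ≤ m := Nat.pos_of_ne_zero fun e => hs' (e ▸ dvd_zero _)
    exact (hlow m h0).symm.isCrit (H.lt (lt_of_two_pow_dvd hm hs hs') le_rfl) (H.1 m s hm hs hs')
  -- Since j and ej agree up to δ, applying j_(2^n+m) makes them agree up to the image of δ, which
  -- is at least δ'. Then j_(2^n+m)(ej) is compared with (e j_(m))(ej) = e(j_(m) j).
  have hhigh : ∀ m, 1 ≤ m → m ≤ 2 ^ n →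
      EqvUpTo δ' (leftPowEmb hlam j (2 ^ n + m)) (app hlam e (leftPowEmb hlam j m)) := by
    intro m hm
    induction m, hm using Nat.le_induction with
    | base =>
      intro _
      rw [leftPowEmb_succ hlam j hpos]
      exact EqvUpTo.refl _ _
    | succ m hm ih =>
      intro hm'
      rw [← add_assoc, leftPowEmb_succ hlam j (by omega), leftPowEmb_succ hlam j hm, app_distrib]
      obtain ⟨s, hs, hs'⟩ := exists_two_pow_dvd hm
      obtain ⟨β, hβ⟩ := exists_mapsOrd (leftPowEmb hlam j (2 ^ n + m)) hcrit.1
      have h1 := himage (.leftPow (2 ^ n + m)) _ β (hcritlow m s (by omega) hs hs')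
        (H.lt (lt_of_two_pow_dvd (by omega) hs hs') le_rfl) hβ
      exact ((EqvUpTo.app_right hlam hβ hej.symm).mono h1).trans
        (EqvUpTo.app_left hlam hlim (ih (by omega)) _)
  -- By `hhigh`, j_(2^(n+1)) agrees with ee up to δ', and crit(ee) = e(δ) ≥ δ'.
  have hnext : δ' ≤ critPow hlam j (n + 1) := by
    by_contra hlt
    rw [not_le] at hlt
    have h1 := hhigh (2 ^ n) hpos le_rfl
    rw [← hpow] at h1
    exact (isCrit_critPow hlam hj (n + 1)).2.1 (h1.symm.mapsOrd_self hlt (hee.2.2 _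
      (hlt.trans_le (hmin ε (hcrit.lt_of_mapsOrd hε)
        (.app (.leftPow (2 ^ n)) (.leftPow (2 ^ n))) hee))))
  refine ⟨fun m s hm hs hs' => ?_, fun s hs => ?_⟩
  · rcases lt_trichotomy m (2 ^ n) with h | rfl | h
    · exact H.1 m s h hs hs'
    · have h1 := (Nat.pow_dvd_pow_iff_le_right (by norm_num)).1 hs
      have h2 : ¬ s + 1 ≤ n := fun h => hs' (pow_dvd_pow 2 h)
      obtain rfl : s = n := by omega
      exact hcrit
    · obtain ⟨c, rfl⟩ := Nat.exists_eq_add_of_le h.le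
      have hsn : s < n := by
        by_contra hc
        have h1 : 2 ^ n ∣ c :=
          (Nat.dvd_add_right dvd_rfl).1 ((pow_dvd_pow 2 (not_lt.1 hc)).trans hs)
        have := Nat.le_of_dvd (by omega) h1
        omega
      exact hcritlow c s (by omega) ((Nat.dvd_add_right (pow_dvd_pow 2 hsn.le)).1 hs)
        fun h => hs' ((Nat.dvd_add_right (pow_dvd_pow 2 hsn)).2 h)
  · rcases Nat.lt_succ_iff_lt_or_eq.1 hs with h | rfl
    · exact H.2 s h
    · exact hδ'.trans_le hnext

theorem critPattern (hj : Nontriv j) (n : ℕ) : CritPattern hlam j n := by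
  induction n with
  | zero => exact critPattern_zero
  | succ n ih => exact ih.succ hj

variable (hlam) in
theorem critPow_strictMono (hj : Nontriv j) : StrictMono (critPow hlam j) :=
  fun _ t h => (critPattern hj t).lt h le_rfl

theorem critPow_mem_critSet (hj : Nontriv j) (n : ℕ) : critPow hlam j n ∈ critSet hlam j :=
  ⟨_, (inAlg_iff hlam j).2 ⟨_, rfl⟩, isCrit_critPow hlam hj n⟩

theorem exists_eq_critPow (hj : Nontriv j) {n : ℕ} {α : Ordinal.{u}} (hα : α ∈ critSet hlam j)
    (h : α < critPow hlam j n) : ∃ s < n, α = critPow hlam j s := by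
  obtain ⟨k, hk, hc⟩ := hα
  obtain ⟨w, rfl⟩ := (inAlg_iff hlam j).1 hk
  exact (critPattern hj n).exists_eq hj hc h

/-- `CritPattern` shows that no critical point of the algebra lies strictly between consecutive crit
j_(2^n) or below the first. -/
theorem gam_eq_critPow (hj : Nontriv j) (n : ℕ) : gam hlam j n = critPow hlam j n := by
  induction n with
  | zero =>
    refine le_antisymm (csInf_le' (critPow_mem_critSet hj 0)) ?_
    refine le_csInf ⟨_, critPow_mem_critSet hj 0⟩ fun α hα => le_of_not_gt fun hlt => ?_
    obtain ⟨s, hs, -⟩ := exists_eq_critPow hj hα hlt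
    omega
  | succ n ih =>
    have hmem : critPow hlam j (n + 1) ∈ {α | α ∈ critSet hlam j ∧ gam hlam j n < α} :=
      ⟨critPow_mem_critSet hj _, ih ▸ critPow_strictMono hlam hj (Nat.lt_succ_self n)⟩
    refine le_antisymm (csInf_le' hmem) ?_
    refine le_csInf ⟨_, hmem⟩ fun α hα => le_of_not_gt fun hlt => ?_
    obtain ⟨s, hs, rfl⟩ := exists_eq_critPow hj hα.1 hlt
    have := (critPow_strictMono hlam hj).lt_iff_lt.1 (ih ▸ hα.2)
    omega

variable (hlam) in
theorem gam_strictMono (hj : Nontriv j) : StrictMono (gam hlam j) := by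
  rw [show gam hlam j = critPow hlam j from funext (gam_eq_critPow hj)]
  exact critPow_strictMono hlam hj

/-! ### Transfer from the finite algebras -/

/-- Up to γ_r the word acts as j_(a), where `a` is its value in the r-th table. This has critical
point γ_r if a = 2^r, and a smaller one otherwise. -/
theorem finCritGE_iff_gam_le (hj : Nontriv j) {w : Word} {κ : Ordinal.{u}}
    (hκ : IsCrit (w.toEmb hlam j) κ) (r : ℕ) : FinCritGE w r ↔ gam hlam j r ≤ κ := by
  rw [gam_eq_critPow hj, Word.finCritGE_iff]
  have heqv := eqvUpTo_critPow hlam hj r w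
  constructor
  · intro h
    by_contra hlt
    rw [h] at heqv
    rw [not_le] at hlt
    exact absurd hlt ((heqv.isCrit hlt hκ).unique (isCrit_critPow hlam hj r)).ge.not_gt
  · intro h
    by_contra hne
    have hlt := lt_of_le_of_ne (Word.val_le r w) hne
    obtain ⟨s, hs, hs'⟩ := exists_two_pow_dvd (Word.one_le_val r w)
    have h1 := critPow_strictMono hlam hj (lt_of_two_pow_dvd hlt hs hs')
    have h2 := heqv.symm.isCrit h1 ((critPattern hj r).1 _ s hlt hs hs')
    exact absurd (h.trans_lt (hκ.unique h2 ▸ h1)) (lt_irrefl _)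

theorem FinCritEq.isCrit (hj : Nontriv j) {w : Word} {n : ℕ} (h : FinCritEq w n) :
    IsCrit (w.toEmb hlam j) (gam hlam j n) := by
  obtain ⟨κ, hκ⟩ := exists_isCrit_toEmb hlam hj w
  have h1 := (finCritGE_iff_gam_le hj hκ n).1 h.1
  have h2 : κ < gam hlam j (n + 1) := by
    rw [← not_le, ← finCritGE_iff_gam_le hj hκ]
    intro hc
    exact absurd (h.2 hc) (by omega)
  rw [gam_eq_critPow hj] at h2
  obtain ⟨s, hs, rfl⟩ := (critPattern hj (n + 1)).exists_eq hj hκ h2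
  rw [← gam_eq_critPow hj] at h1 hκ
  have := (gam_strictMono hlam hj).le_iff_le.1 h1
  obtain rfl : s = n := by omega
  exact hκ

theorem isCrit_app_leftPow (hj : Nontriv j) {w : Word} {n : ℕ} {β : Ordinal.{u}}
    (h : MapsOrd (w.toEmb hlam j) (gam hlam j n) β) :
    IsCrit ((Word.app w (.leftPow (2 ^ n))).toEmb hlam j) β := by
  rw [gam_eq_critPow hj] at h
  exact (isCrit_critPow hlam hj n).app hlam h

theorem exists_mapsOrd_gam (hj : Nontriv j) (k : Emb lam) (n : ℕ) :
    ∃ β, MapsOrd k (gam hlam j n) β := by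
  rw [gam_eq_critPow hj]
  exact exists_mapsOrd _ (isCrit_critPow hlam hj n).1

theorem finApplyGE_iff_gam_le (hj : Nontriv j) {w : Word} {s r : ℕ} {β : Ordinal.{u}}
    (h : MapsOrd (w.toEmb hlam j) (gam hlam j s) β) : FinApplyGE w s r ↔ gam hlam j r ≤ β :=
  finCritGE_iff_gam_le hj (isCrit_app_leftPow hj h) r

theorem FinApplyEq.mapsOrd (hj : Nontriv j) {w : Word} {s t : ℕ} (h : FinApplyEq w s t) :
    MapsOrd (w.toEmb hlam j) (gam hlam j s) (gam hlam j t) := by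
  obtain ⟨β, hβ⟩ := exists_mapsOrd_gam hj (w.toEmb hlam j) s
  have h1 : IsCrit _ (gam hlam j t) := FinCritEq.isCrit (w := .app w (.leftPow (2 ^ s))) hj h
  rwa [(isCrit_app_leftPow hj hβ).unique h1] at hβ

theorem FinSeq.embSeq (hj : Nontriv j) {w : Word} {a b c : ℕ} (h : FinSeq w a b c) :
    EmbSeq (w.toEmb hlam j) (gam hlam j a) (gam hlam j b) (gam hlam j c) :=
  ⟨h.1.isCrit hj, h.2.1.mapsOrd hj, h.2.2.mapsOrd hj⟩

theorem finCritGE_of_toEmb_eq (hj : Nontriv j) {v w : Word}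
    (h : v.toEmb hlam j = w.toEmb hlam j) {r : ℕ} : FinCritGE v r ↔ FinCritGE w r := by
  obtain ⟨κ, hκ⟩ := exists_isCrit_toEmb hlam hj v
  rw [finCritGE_iff_gam_le hj hκ, finCritGE_iff_gam_le hj (h ▸ hκ)]

end Generated

end EmbAlg

theorem theorem3p1 :
    -- elementary embeddings
    (∀ (lam : Ordinal.{u}) (hlam : Order.IsSuccLimit lam) (j : EmbAlg.Emb lam),
      EmbAlg.Nontriv j → ∀ n : ℕ,
        (∀ m < n, ∃ κ : EmbAlg.Emb lam, EmbAlg.InAlg hlam j κ ∧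
          EmbAlg.EmbSeq κ (EmbAlg.gam hlam j (2 ^ n - 2 ^ (m + 1)))
            (EmbAlg.gam hlam j (2 ^ n - 2 ^ m)) (EmbAlg.gam hlam j (2 ^ n))) ∧
        (∀ k : EmbAlg.Emb lam, EmbAlg.InAlg hlam j k →
          ∀ r s : ℕ, EmbAlg.HasResidue hlam j (2 ^ n) k r →
            EmbAlg.HasResidue hlam j (2 ^ (n + 1)) k s → r ≠ 0 →
            ∃ β : Ordinal.{u}, EmbAlg.MapsOrd k (EmbAlg.gam hlam j (2 ^ n)) β ∧
              EmbAlg.gam hlam j (2 ^ (n + 1)) ≤ β ∧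
              (2 ^ 2 ^ n < s → EmbAlg.gam hlam j (2 ^ (n + 1)) < β)) ∧
        EmbAlg.EmbSeq ((EmbAlg.Word.leftPow (2 ^ 2 ^ n - 1)).toEmb hlam j)
          (EmbAlg.gam hlam j 0) (EmbAlg.gam hlam j (2 ^ n))
          (EmbAlg.gam hlam j (2 ^ (n + 1)))) ∧
    -- finite algebras
    (∀ n : ℕ,
      (∀ m < n, ∃ κ : EmbAlg.Word,
        EmbAlg.FinSeq κ (2 ^ n - 2 ^ (m + 1)) (2 ^ n - 2 ^ m) (2 ^ n)) ∧
      (∀ k : EmbAlg.Word, k.residue (2 ^ n) ≠ 0 →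
        EmbAlg.FinApplyGE k (2 ^ n) (2 ^ (n + 1)) ∧
        (2 ^ 2 ^ n < k.residue (2 ^ (n + 1)) →
          EmbAlg.FinApplyGE k (2 ^ n) (2 ^ (n + 1) + 1))) ∧
      EmbAlg.FinSeq (EmbAlg.Word.leftPow (2 ^ 2 ^ n - 1)) 0 (2 ^ n) (2 ^ (n + 1))) := by
  refine ⟨fun lam hlam j hj n => ⟨fun m hm => ?_, fun k hk r s hr hs hr0 => ?_, ?_⟩,
    fun n => ⟨fun m hm => EmbAlg.exists_finSeq hm, fun k hk => EmbAlg.finApplyGE_two_pow hk,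
      EmbAlg.finSeq_leftPow n⟩⟩
  · obtain ⟨κ, hκ⟩ := EmbAlg.exists_finSeq hm
    exact ⟨_, (EmbAlg.inAlg_iff hlam j).2 ⟨κ, rfl⟩, hκ.embSeq hj⟩
  · obtain ⟨v, rfl, rfl⟩ := hr
    obtain ⟨w, hw, rfl⟩ := hs
    obtain ⟨β, hβ⟩ := EmbAlg.exists_mapsOrd_gam (hlam := hlam) hj (v.toEmb hlam j) (2 ^ n)
    refine ⟨β, hβ, (EmbAlg.finApplyGE_iff_gam_le hj hβ).1 (EmbAlg.finApplyGE_two_pow hr0).1,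
      fun hlt => ?_⟩
    -- The two residues may come from different words for the same embedding; nonvanishing depends
    -- only on the embedding.
    have hr0' : w.residue (2 ^ n) ≠ 0 := fun h0 =>
      hr0 ((EmbAlg.finCritGE_of_toEmb_eq hj hw).1 h0)
    refine lt_of_lt_of_le (EmbAlg.gam_strictMono hlam hj (Nat.lt_succ_self _))
      ((EmbAlg.finApplyGE_iff_gam_le (w := w) hj (by rwa [hw])).1
        ((EmbAlg.finApplyGE_two_pow hr0').2 hlt))
  · exact (EmbAlg.finSeq_leftPow n).embSeq hj
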